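/- Consider $n\ge 2$ players, where player $i$ has a finite set $\mathcal A_i$ of $m_i\ge 2$ actions and $\Delta(\mathcal A_i)$ denotes the simplex of mixed strategies. Fix a horizon $T\ge 1$ and put $$\eta=\frac{1}{128(n-1)\max_j\sqrt{m_j}},\qquad C=8192\,(n-1)\max_j m_j\sum_{j=1}^n m_j^2,\qquad \eta_i'=\sqrt{\frac{m_i\log m_i}{T}},$$ $$B_i(S)=256\max_{j}\sqrt{m_j}\Big((n-1)m_i^2+\sum_{j=1}^n m_j^2\Big)\log S .$$ In each round $t=0,1,2,\dots$ a learner over $\Delta(\mathcal A)$ plays $x^{(t)}\in\Delta(\mathcal A)$, depending only on the previously observed utility vectors $u^{(0)},\dots,u^{(t-1)}\in\mathbb R^{\mathcal A}$, and then observes $u^{(t)}$ (round $0$ only provides an initial observation and does not count for the regret). Its swap regret up to time $S$ is $$\mathrm{SwapReg}^S=\max_{\phi}\sum_{t=1}^S\langle \phi(x^{(t)})-x^{(t)},u^{(t)}\rangle,$$ the maximum being over all linear maps $\phi$ that map $\Delta(\mathcal A)$ into itself. The Blum--Mansour (BM) construction keeps one external regret minimizer for each action $a\in\mathcal A$. In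 round $t$ the minimizer of $a$ proposes $x_a^{(t)}\in\Delta(\mathcal A)$, the learner plays a stationary distribution $x^{(t)}$ of the row-stochastic matrix with rows $x_a^{(t)}$, and the utility $u_a^{(t)}=x^{(t)}[a]\,u^{(t)}$ is forwarded to the minimizer of $a$. In BM-OFTRL-LogBar with learning rate $\eta$, the proposal $x_a^{(0)}$ is uniform, and for $t\ge1$, $x_a^{(t)}$ is the maximizer of $\eta\big\langle x,\,u_a^{(t-1)}+\sum_{\tau=1}^{t-1}u_a^{(\tau)}\big\rangle+\sum_{r}\log x[r]$ over the relative interior of $\Delta(\mathcal A)$. In BM-MWU with learning rate $\eta'$ started in round $t_0$, for $t\ge t_0$ one has $x_a^{(t)}[b]\propto\exp\big(\eta'\sum_{\tau=t_0}^{t-1}u_a^{(\tau)}[b]\big)$. Then there exist learners, one for each player $i$ and not depending on the utilities of any game, of the following form: player $i$ runs BM-OFTRL-LogBar with learning rate $\eta$ up to and including the first round $t\ge2$ (if any) in which $$\sum_{\tau=1}^t\|u_i^{(\tau)}-u_i^{(\tau-1)}\|_\infty^2> C\log t,$$ and from round $t+1$ on runs a freshly started BM-MWU with learning rate $\eta_i'$.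 They satisfy the following. 1. If all players use these dynamics in a repeated normal-form game with utilities $u_i:\prod_j\mathcal A_j\to[-1,1]$, where after round $t$ player $i$ observes the vector $u_i^{(t)}[a_i]=\mathbb E_{a_{-i}\sim x_{-i}^{(t)}}[u_i(a_i,a_{-i})]$, then $\mathrm{SwapReg}_i^{T'}\le B_i(T')$ for every player $i$ and every $T'\ge 2$. 2. For every player $i$ and every sequence of utility vectors with $\|u_i^{(t)}\|_\infty\le 1$ for all $0\le t\le T$, $$\mathrm{SwapReg}_i^T\le B_i(T)+2\sqrt{m_i\log m_i\,T}+2 .$$ -/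

import Mathlib

/-! ### Online learning over the simplex -/

/-- A deterministic learner over the simplex `Δ(A)` in the full-information model: in round `t` it
plays a mixed strategy determined by the utility vectors `u⁽⁰⁾, …, u⁽ᵗ⁻¹⁾` it has observed. -/
abbrev Learner (A : Type*) [Fintype A] : Type _ :=
  ∀ t : ℕ, (Fin t → A → ℝ) → stdSimplex ℝ A

/-- The strategies played by the learner `D` against the utility sequence `u`. -/
def Learner.run {A : Type*} [Fintype A] (D : Learner A) (u : ℕ → A → ℝ) (t : ℕ) :
    stdSimplex ℝ A :=
  D t (fun s => u s)

/-- The gains `∑ₜ ⟨φ(x⁽ᵗ⁾), u⁽ᵗ⁾⟩ - ∑ₜ ⟨x⁽ᵗ⁾, u⁽ᵗ⁾⟩` over rounds `1, …, T`, where `φ` ranges over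
all linear transformations of the simplex into itself. -/
def swapGains {A : Type*} [Fintype A] (x : ℕ → stdSimplex ℝ A) (u : ℕ → A → ℝ) (T : ℕ) : Set ℝ :=
  {r | ∃ φ : (A → ℝ) →ₗ[ℝ] (A → ℝ), Set.MapsTo φ (stdSimplex ℝ A) (stdSimplex ℝ A) ∧
    r = (∑ t ∈ Finset.Icc 1 T, ∑ a, φ (x t).1 a * u t a)
      - ∑ t ∈ Finset.Icc 1 T, ∑ a, (x t).1 a * u t a}

/-- Swap regret up to time `T`. -/
noncomputable def swapRegret {A : Type*} [Fintype A] (x : ℕ → stdSimplex ℝ A) (u : ℕ → A → ℝ)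
    (T : ℕ) : ℝ :=
  sSup (swapGains x u T)

/-- The supremum defining swap regret is a genuine least upper bound. -/
theorem swapRegret_isLUB {A : Type*} [Fintype A] (x : ℕ → stdSimplex ℝ A) (u : ℕ → A → ℝ)
    (T : ℕ) : IsLUB (swapGains x u T) (swapRegret x u T) := by
  refine isLUB_csSup ⟨_, LinearMap.id, fun _ h => h, rfl⟩
    ⟨(∑ t ∈ Finset.Icc 1 T, ∑ a, |u t a|)
      - ∑ t ∈ Finset.Icc 1 T, ∑ a, (x t).1 a * u t a, ?_⟩
  rintro r ⟨φ, hφ, rfl⟩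
  refine sub_le_sub_right (Finset.sum_le_sum fun t _ => Finset.sum_le_sum fun a _ => ?_) _
  have hs := hφ (x t).2
  have h0 : 0 ≤ φ (x t).1 a := hs.1 a
  have h1 : φ (x t).1 a ≤ 1 := by
    rw [← hs.2]
    exact Finset.single_le_sum (fun b _ => hs.1 b) (Finset.mem_univ a)
  calc φ (x t).1 a * u t a ≤ φ (x t).1 a * |u t a| :=
        mul_le_mul_of_nonneg_left (le_abs_self _) h0
    _ ≤ 1 * |u t a| := mul_le_mul_of_nonneg_right h1 (abs_nonneg _)
    _ = |u t a| := one_mul _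

/-! ### External regret minimizers and the Blum–Mansour construction -/

/-- An update rule of an external regret minimizer: `R t v p` says that `p` is the strategy of
round `t` when the utilities observed so far are `v 0, …, v (t - 1)`. -/
abbrev UpdateRule (A : Type*) [Fintype A] : Type _ :=
  ℕ → (ℕ → A → ℝ) → stdSimplex ℝ A → Prop

/-- The log-barrier regularizer on the (relative interior of the) simplex. -/
noncomputable def logBarrier {A : Type*} [Fintype A] (p : A → ℝ) : ℝ :=
  -∑ a, Real.log (p a)

/-- `p` maximizes `η ⟨p, w⟩ - ∑ₐ (- log p[a])` over the relative interior of the simplex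
(the barrier is `+∞` on the relative boundary). -/
def IsBarrierArgmax {A : Type*} [Fintype A] (η : ℝ) (w : A → ℝ) (p : stdSimplex ℝ A) : Prop :=
  (∀ a, 0 < p.1 a) ∧
    ∀ q ∈ stdSimplex ℝ A, (∀ a, 0 < q a) →
      η * (∑ a, q a * w a) - logBarrier q ≤ η * (∑ a, p.1 a * w a) - logBarrier p.1

/-- Optimistic follow the regularized leader with the log-barrier, learning rate `η` and
prediction `v⁽ᵗ⁻¹⁾`: for `t ≥ 1`, the strategy `x⁽ᵗ⁾` maximizes
`η ⟨x, v⁽ᵗ⁻¹⁾ + ∑_{τ=1}^{t-1} v^(τ)⟩ - R(x)`; and `x⁽⁰⁾` minimizes `R`. -/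
def oftrlLogBar {A : Type*} [Fintype A] (η : ℝ) : UpdateRule A := fun t v p =>
  IsBarrierArgmax η ((if t = 0 then 0 else v (t - 1)) + ∑ τ ∈ Finset.Ico 1 t, v τ) p

/-- Multiplicative weights update with learning rate `η`, started uniformly in round `0`. -/
def mwu {A : Type*} [Fintype A] (η : ℝ) : UpdateRule A := fun t v p =>
  ∀ b, p.1 b = Real.exp (η * ∑ τ ∈ Finset.range t, v τ b) /
    ∑ c, Real.exp (η * ∑ τ ∈ Finset.range t, v τ c)

/-- Round `t` of the Blum–Mansour master algorithm whose regret minimizers (one for each action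
`a`) follow the rule `R` on the forwarded utilities `x^(τ)[a] u^(τ)`: the strategy played is a
stationary distribution of the row-stochastic matrix `Q` formed by their strategies. -/
def BlumMansourStep {A : Type*} [Fintype A] (R : UpdateRule A) (x : ℕ → stdSimplex ℝ A)
    (u : ℕ → A → ℝ) (t : ℕ) : Prop :=
  ∃ Q : A → stdSimplex ℝ A,
    (∀ a, R t (fun τ => (x τ).1 a • u τ) (Q a)) ∧
    ∀ b, ∑ a, (x t).1 a * (Q a).1 b = (x t).1 b

/-! ### The adaptive dynamics -/

/-- The test of round `t ≥ 2` fails: the second-order variation (in the sup norm) of the observed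
utilities exceeds `C log t`. -/
def VariationExceeds {A : Type*} [Fintype A] (C : ℝ) (u : ℕ → A → ℝ) (t : ℕ) : Prop :=
  2 ≤ t ∧ C * Real.log t < ∑ τ ∈ Finset.Icc 1 t, ‖u τ - u (τ - 1)‖ ^ 2

/-- `D` runs BM-OFTRL-LogBar with learning rate `η` up to and including the first round in which
the observed variation exceeds `C log t`, and from the next round on runs a freshly started
BM-MWU with learning rate `η'`. (These requirements determine every strategy of `D`.) -/
def IsAdaptiveDynamics {A : Type*} [Fintype A] (η C η' : ℝ) (D : Learner A) : Prop :=
  ∀ u : ℕ → A → ℝ,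
    (∀ t, (∀ s < t, ¬ VariationExceeds C u s) →
      BlumMansourStep (oftrlLogBar η) (D.run u) u t) ∧
    (∀ s, IsLeast {r | VariationExceeds C u r} s → ∀ k,
      BlumMansourStep (mwu η') (fun j => D.run u (s + 1 + j)) (fun j => u (s + 1 + j)) k)

/-! ### Finite games in normal form -/

/-- The utility vector `b ↦ u_i(b; x_{-i})` observed by player `i` under the mixed profile `x`. -/
noncomputable def utilityVector {n : ℕ} {A : Fin n → Type*} [∀ i, Fintype (A i)]
    [∀ i, DecidableEq (A i)] (U : Fin n → (∀ j, A j) → ℝ) (x : ∀ j, stdSimplex ℝ (A j))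
    (i : Fin n) (b : A i) : ℝ :=
  ∑ a : (∀ j, A j) with a i = b, U i a * ∏ j ∈ Finset.univ.erase i, (x j).1 (a j)

/-- The mixed strategies played in the repeated game when each player `i` uses the learner `D i`
and observes only its own utility vectors. -/
noncomputable def play {n : ℕ} {A : Fin n → Type*} [∀ i, Fintype (A i)]
    [∀ i, DecidableEq (A i)] (U : Fin n → (∀ j, A j) → ℝ) (D : ∀ i, Learner (A i)) (t : ℕ) :
    ∀ i, stdSimplex ℝ (A i) :=
  fun i => D i t (fun s : Fin t => utilityVector U (play U D s.1) i)
termination_by t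
decreasing_by exact s.2

/-- `max_j m_j`, where `m_j` is the number of actions of player `j`. -/
def maxActions {n : ℕ} (A : Fin n → Type*) [∀ i, Fintype (A i)] : ℕ :=
  Finset.univ.sup fun j => Fintype.card (A j)

/-- `∑_j m_j ^ 2`. -/
def sumSqActions {n : ℕ} (A : Fin n → Type*) [∀ i, Fintype (A i)] : ℕ :=
  ∑ j, Fintype.card (A j) ^ 2

/-- The learning rate `1 / (128 (n - 1) max_j √m_j)`. -/
noncomputable def oftrlRate {n : ℕ} (A : Fin n → Type*) [∀ i, Fintype (A i)] : ℝ :=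
  1 / (128 * ((n : ℝ) - 1) * √(maxActions A))

/-- The constant `8192 (n - 1) max_j m_j ∑_j m_j ^ 2` of the variation test. -/
noncomputable def variationConst {n : ℕ} (A : Fin n → Type*) [∀ i, Fintype (A i)] : ℝ :=
  8192 * ((n : ℝ) - 1) * maxActions A * sumSqActions A

/-- `256 max_j √m_j ((n - 1) m_i ^ 2 + ∑_j m_j ^ 2) log T`. -/
noncomputable def logRegretBound {n : ℕ} (A : Fin n → Type*) [∀ i, Fintype (A i)] (i : Fin n)
    (T : ℕ) : ℝ :=
  256 * √(maxActions A) *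
    (((n : ℝ) - 1) * (Fintype.card (A i) : ℝ) ^ 2 + sumSqActions A) * Real.log T

/-! Swap regret is never negative, so a regret bound with a negative path-length term is also an
upper bound on the path length.

Stationarity turns the swap regret of the Blum–Mansour construction into the sum of the external
regrets of the per-action minimizers (`swapRegret_le_of_stationary`). For optimistic FTRL with the
log-barrier, this sum is at most m² log T / η, plus η times the squared variation of the utilities
and of the weights x[a], minus the Bregman divergences between consecutive proposals divided by 2η,
up to constants. A stationary distribution moves little when the rows change by small relative
amounts, so these divergences dominate the squared ℓ¹ movement of x (`l1Dist_sq_le_sum_barrierDiv`).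
Half of that movement absorbs the variation of the weights; the other half survives as a negative
term in `oftrlLogBar_swapRegret_le`.

In self-play the utilities of a player move no more than the strategies of the others. Summing the
regret bounds over the players, using nonnegativity on the left and the small learning rate on the
right, bounds the total squared path length by a multiple of log t, and hence the variation by C log
t. By strong induction on t no test ever fails (`not_variationExceeds_play`): as long as the earlier
tests pass for everybody, all players are still running optimistic FTRL in round t. The variation
bound then gives the logarithmic regret of each single player.

Against an adversary, the variation is below the threshold before the first failed test, which gives
the same logarithmic bound up to the switch. BM-MWU pays the square-root term afterwards, and swap
regret is subadditive under restarts. -/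

/-! ### Scalar inequalities for the logarithm -/

/-- A bound on the convex conjugate of (d - log (1 + d)) / 2 near zero. The maximizing d satisfies
(1 - 2z)(1 + d) = 1, which is why the tangent inequality for log is applied to this product; a
Taylor bound for log (1 - 2z) does the rest. -/
theorem log_one_add_le_quadratic {z d : ℝ} (hz : |z| ≤ 1 / 6) (hd : -1 < d) :
    z * d - (d - Real.log (1 + d)) / 2 ≤ 2 * z ^ 2 := by
  have hy : |2 * z| ≤ 1 / 3 := by rw [abs_mul, abs_two]; linarith
  have hy2 := abs_le.1 hy
  have h1 := Real.abs_log_sub_add_sum_range_le (x := 2 * z) (by linarith) 2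
  have h2 : |2 * z| ^ (2 + 1) / (1 - |2 * z|) ≤ (2 * z) ^ 2 / 2 := by
    rw [div_le_iff₀ (by linarith), ← sq_abs (2 * z)]
    have : 0 ≤ |2 * z| ^ 2 := by positivity
    nlinarith
  have h3 := neg_abs_le (∑ i ∈ Finset.range 2, (2 * z) ^ (i + 1) / (i + 1) + Real.log (1 - 2 * z))
  norm_num [Finset.sum_range_succ] at h1 h3 h2
  have h4 : Real.log (1 - 2 * z) + Real.log (1 + d) ≤ (1 - 2 * z) * (1 + d) - 1 := by
    rw [← Real.log_mul (by linarith) (by linarith)]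
    exact Real.log_le_sub_one_of_pos (mul_pos (by linarith) (by linarith))
  nlinarith

/-- With r = s², the tangent inequality for log s makes the right side at least 4(s - 1)². Since ε /
(1 + ε) is bounded, the estimate is global in r, so consecutive iterates need not be shown to be
close beforehand. -/
theorem sq_div_one_add_le_sub_log {r : ℝ} (hr : 0 < r) :
    (|r - 1| / (1 + |r - 1|)) ^ 2 ≤ 4 * (r - 1 - Real.log r) := by
  obtain ⟨s, hs, rfl⟩ : ∃ s : ℝ, 0 < s ∧ r = s ^ 2 :=
    ⟨√r, Real.sqrt_pos.2 hr, (Real.sq_sqrt hr.le).symm⟩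
  have h1 : Real.log (s ^ 2) ≤ 2 * (s - 1) := by
    rw [Real.log_pow]
    have := Real.log_le_sub_one_of_pos hs
    push_cast; linarith
  have h2 : (|s ^ 2 - 1| / (1 + |s ^ 2 - 1|)) ≤ 2 * |s - 1| := by
    have e : |s ^ 2 - 1| = |s - 1| * (s + 1) := by
      rw [← abs_of_pos (show 0 < s + 1 by linarith), ← abs_mul]; ring_nf
    rw [div_le_iff₀ (by positivity), e]
    have h0 := abs_nonneg (s - 1)
    rcases le_total 1 s with h | h
    · have h3 := abs_of_nonneg (sub_nonneg.2 h)
      nlinarith [mul_nonneg h0 h0, mul_nonneg h0 (mul_nonneg h0 hs.le)]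
    · nlinarith [mul_nonneg h0 (mul_nonneg h0 hs.le), mul_nonneg h0 h0]
  calc _ ≤ (2 * |s - 1|) ^ 2 := pow_le_pow_left₀ (by positivity) h2 2
    _ = 4 * (s - 1) ^ 2 := by rw [mul_pow, sq_abs]; norm_num
    _ ≤ _ := by nlinarith

/-! ### The log-barrier and optimistic FTRL -/

section Barrier

variable {A : Type*} [Fintype A]

/-- The Bregman divergence of the log-barrier. -/
noncomputable def barrierDiv (q p : A → ℝ) : ℝ :=
  ∑ b, (q b / p b - 1 - Real.log (q b / p b))

theorem sub_one_sub_log_nonneg {r : ℝ} (hr : 0 < r) : 0 ≤ r - 1 - Real.log r := by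
  linarith [Real.log_le_sub_one_of_pos hr]

theorem barrierDiv_nonneg {q p : A → ℝ} (hq : ∀ b, 0 < q b) (hp : ∀ b, 0 < p b) :
    0 ≤ barrierDiv q p :=
  Finset.sum_nonneg fun b _ => sub_one_sub_log_nonneg (div_pos (hq b) (hp b))

theorem sq_div_one_add_le_barrierDiv {q p : A → ℝ} (hq : ∀ b, 0 < q b) (hp : ∀ b, 0 < p b)
    (b : A) : (|q b / p b - 1| / (1 + |q b / p b - 1|)) ^ 2 ≤ 4 * barrierDiv q p := by
  refine (sq_div_one_add_le_sub_log (div_pos (hq b) (hp b))).trans ?_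
  refine mul_le_mul_of_nonneg_left ?_ (by norm_num)
  exact Finset.single_le_sum (f := fun b => q b / p b - 1 - Real.log (q b / p b))
    (fun c _ => sub_one_sub_log_nonneg (div_pos (hq c) (hp c))) (Finset.mem_univ b)

/-- The maximizer is interior, so the segment towards q extends beyond it on both sides and the
directional derivative vanishes. The equality lets the Bregman divergence appear without loss. -/
theorem IsBarrierArgmax.first_order {η : ℝ} {w : A → ℝ} {p : stdSimplex ℝ A}
    (h : IsBarrierArgmax η w p) {q : A → ℝ} (hq : q ∈ stdSimplex ℝ A) :
    η * ((q - p.1) ⬝ᵥ w) + ∑ b, (q b / p.1 b - 1) = 0 := by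
  have hp := h.1
  set F : ℝ → ℝ := fun s => η * (∑ a, (p.1 a + s * (q a - p.1 a)) * w a)
    + ∑ a, Real.log (p.1 a + s * (q a - p.1 a)) with hF
  have hder : HasDerivAt F (η * (∑ a, (q a - p.1 a) * w a) + ∑ a, (q a - p.1 a) / p.1 a) 0 := by
    have hl : ∀ a, HasDerivAt (fun s : ℝ => p.1 a + s * (q a - p.1 a)) (q a - p.1 a) 0 := by
      intro a
      simpa using ((hasDerivAt_id (0 : ℝ)).mul_const (q a - p.1 a)).const_add (p.1 a)
    refine HasDerivAt.add ?_ ?_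
    · refine HasDerivAt.const_mul _ (HasDerivAt.fun_sum fun a _ => ?_)
      exact (hl a).mul_const _
    · refine HasDerivAt.fun_sum fun a _ => ?_
      simpa using (hl a).log (by simpa using (hp a).ne')
  have hmax : IsLocalMax F 0 := by
    have hpos : ∀ᶠ s in nhds (0 : ℝ), ∀ a, 0 < p.1 a + s * (q a - p.1 a) := by
      rw [Filter.eventually_all]
      intro a
      have : ContinuousAt (fun s : ℝ => p.1 a + s * (q a - p.1 a)) 0 := by fun_prop
      exact this.eventually_const_lt (by simpa using hp a)
    filter_upwards [hpos] with s hs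
    have hmem : (fun a => p.1 a + s * (q a - p.1 a)) ∈ stdSimplex ℝ A := by
      refine ⟨fun a => (hs a).le, ?_⟩
      rw [Finset.sum_add_distrib, ← Finset.mul_sum, Finset.sum_sub_distrib, hq.2, p.2.2]
      simp
    have := h.2 _ hmem hs
    simpa [hF, logBarrier] using this
  have h0 := hmax.hasDerivAt_eq_zero hder
  rw [← h0]
  congr 1
  exact Finset.sum_congr rfl fun b _ => by rw [sub_div, div_self (hp b).ne']

/-- The growth of the regularized objective away from its optimum. -/
theorem IsBarrierArgmax.add_barrierDiv_le {η : ℝ} {w : A → ℝ} {p : stdSimplex ℝ A}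
    (h : IsBarrierArgmax η w p) {q : A → ℝ} (hq : q ∈ stdSimplex ℝ A) (hq0 : ∀ a, 0 < q a) :
    logBarrier p.1 - η * (p.1 ⬝ᵥ w) + barrierDiv q p.1 ≤ logBarrier q - η * (q ⬝ᵥ w) := by
  have h1 := h.first_order hq
  have h2 : barrierDiv q p.1 = ∑ b, (q b / p.1 b - 1) + logBarrier q - logBarrier p.1 := by
    unfold barrierDiv logBarrier
    rw [Finset.sum_sub_distrib]
    have : ∑ b, Real.log (q b / p.1 b) = ∑ b, Real.log (q b) - ∑ b, Real.log (p.1 b) := by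
      rw [← Finset.sum_sub_distrib]
      exact Finset.sum_congr rfl fun b _ => Real.log_div (hq0 b).ne' (h.1 b).ne'
    rw [this]; ring
  rw [sub_dotProduct] at h1
  linarith

theorem exists_isBarrierArgmax [Nonempty A] (η : ℝ) (w : A → ℝ) :
    ∃ p : stdSimplex ℝ A, IsBarrierArgmax η w p := by
  classical
  set f : (A → ℝ) → ℝ := fun q => η * (∑ a, q a * w a) - logBarrier q with hf
  set m : ℝ := (Fintype.card A : ℝ) with hm
  have hmpos : 0 < m := by rw [hm]; exact_mod_cast Fintype.card_pos
  have hu : (fun _ => m⁻¹ : A → ℝ) ∈ stdSimplex ℝ A :=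
    ⟨fun _ => by positivity, by simp [← hm, hmpos.ne']⟩
  set M : ℝ := |η| * ∑ a, |w a| with hM
  have hlin : ∀ q ∈ stdSimplex ℝ A, η * (∑ a, q a * w a) ≤ M := by
    intro q hq
    refine (le_abs_self _).trans ?_
    rw [abs_mul]
    refine mul_le_mul_of_nonneg_left ?_ (abs_nonneg _)
    refine (Finset.abs_sum_le_sum_abs _ _).trans (Finset.sum_le_sum fun a _ => ?_)
    rw [abs_mul, abs_of_nonneg (hq.1 a)]
    have : q a ≤ 1 := by
      rw [← hq.2]; exact Finset.single_le_sum (fun b _ => hq.1 b) (Finset.mem_univ a)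
    nlinarith [abs_nonneg (w a)]
  -- Below this level in some coordinate, the barrier alone pushes the objective under its value at
  -- the uniform strategy, so the maximum over the compact set where all coordinates are at least c
  -- is global.
  set c : ℝ := min m⁻¹ (Real.exp (f (fun _ => m⁻¹) - M)) with hc
  have hcpos : 0 < c := lt_min (by positivity) (Real.exp_pos _)
  set K : Set (A → ℝ) := stdSimplex ℝ A ∩ {q | ∀ a, c ≤ q a} with hK
  have hKc : IsCompact K := by
    refine (isCompact_stdSimplex ℝ A).inter_right ?_
    simp only [Set.ofPred_forall]
    exact isClosed_iInter fun a => isClosed_le continuous_const (continuous_apply a)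
  have hfc : ContinuousOn f K := by
    refine ContinuousOn.sub (by fun_prop) ?_
    unfold logBarrier
    refine ContinuousOn.neg (continuousOn_finsetSum _ fun a _ => ?_)
    refine ContinuousOn.log (by fun_prop) fun q hq => ?_
    exact (hcpos.trans_le (hq.2 a)).ne'
  obtain ⟨p, hp, hmax⟩ := hKc.exists_isMaxOn ⟨_, hu, fun _ => min_le_left _ _⟩ hfc
  refine ⟨⟨p, hp.1⟩, fun a => hcpos.trans_le (hp.2 a), fun q hq hq0 => ?_⟩
  by_cases hqK : ∀ a, c ≤ q a
  · exact hmax ⟨hq, hqK⟩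
  · push Not at hqK
    obtain ⟨a, ha⟩ := hqK
    have h1 : f (fun _ => m⁻¹) ≤ f p := hmax ⟨hu, fun _ => min_le_left _ _⟩
    refine le_trans ?_ h1
    have hlog : ∑ b, Real.log (q b) ≤ Real.log (q a) := by
      rw [← Finset.add_sum_erase _ _ (Finset.mem_univ a)]
      have : ∑ b ∈ Finset.univ.erase a, Real.log (q b) ≤ 0 := by
        refine Finset.sum_nonpos fun b _ => Real.log_nonpos (hq0 b).le ?_
        rw [← hq.2]; exact Finset.single_le_sum (fun b _ => hq.1 b) (Finset.mem_univ b)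
      linarith
    have h2 : Real.log (q a) ≤ f (fun _ => m⁻¹) - M := by
      rw [Real.log_le_iff_le_exp (hq0 a)]
      exact ha.le.trans (min_le_right _ _)
    have := hlin q hq
    simp only [logBarrier]
    linarith

/-- The regret of optimistic FTRL with the log-barrier in terms of the divergences between
consecutive strategies. -/
theorem oftrlLogBar_regret_le {η : ℝ} {N : ℕ} {v : ℕ → A → ℝ} {p : ℕ → stdSimplex ℝ A}
    (h : ∀ t ≤ N + 1, oftrlLogBar η t v (p t)) {q : A → ℝ} (hq : q ∈ stdSimplex ℝ A)
    (hq0 : ∀ a, 0 < q a) :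
    η * ∑ t ∈ Finset.range (N + 1), (q - (p (t + 1)).1) ⬝ᵥ v (t + 1) ≤
      logBarrier q - logBarrier (p 0).1
        + η * ((q - (p (N + 1)).1) ⬝ᵥ (v (N + 1) - v N))
        + η * ∑ t ∈ Finset.range N, ((p (t + 2)).1 - (p (t + 1)).1) ⬝ᵥ (v (t + 1) - v t)
        - ∑ t ∈ Finset.range (N + 1), barrierDiv (p (t + 1)).1 (p t).1 := by
  set W : ℕ → A → ℝ := fun t => (if t = 0 then 0 else v (t - 1)) + ∑ τ ∈ Finset.Ico 1 t, v τ
    with hW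
  have hW1 : ∀ t, W (t + 1) = v t + ∑ s ∈ Finset.range t, v (s + 1) := by
    intro t
    simp [hW, Finset.sum_Ico_eq_sum_range, add_comm]
  have hstep : ∀ k ≤ N, logBarrier (p 0).1
      + ∑ t ∈ Finset.range (k + 1), barrierDiv (p (t + 1)).1 (p t).1
      - η * ∑ t ∈ Finset.range k, (p (t + 1)).1 ⬝ᵥ v (t + 1) - η * ((p (k + 1)).1 ⬝ᵥ v k)
      - η * ∑ t ∈ Finset.range k, ((p (t + 2)).1 - (p (t + 1)).1) ⬝ᵥ (v (t + 1) - v t)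
      ≤ logBarrier (p (k + 1)).1 - η * ((p (k + 1)).1 ⬝ᵥ W (k + 1)) := by
    intro k
    induction k with
    | zero =>
      intro hk
      have h1 := (h 0 (by omega)).add_barrierDiv_le (p 1).2 (h 1 (by omega)).1
      simp [hW1] at h1 ⊢
      linarith
    | succ k ih =>
      intro hk
      have h1 := (h (k + 1) (by omega)).add_barrierDiv_le (p (k + 2)).2 (h (k + 2) (by omega)).1
      have h2 := ih (by omega)
      rw [Finset.sum_range_succ _ k] at h2
      change logBarrier (p (k + 1)).1 - η * ((p (k + 1)).1 ⬝ᵥ W (k + 1))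
        + barrierDiv (p (k + 2)).1 (p (k + 1)).1
        ≤ logBarrier (p (k + 2)).1 - η * ((p (k + 2)).1 ⬝ᵥ W (k + 1)) at h1
      -- The new utility enters twice, once as an observation and once as the next prediction, and
      -- the old prediction leaves.
      have h3 : W (k + 2) = W (k + 1) + (2 : ℝ) • v (k + 1) - v k := by
        rw [hW1, hW1, Finset.sum_range_succ]; module
      rw [Finset.sum_range_succ _ (k + 1), Finset.sum_range_succ _ k, Finset.sum_range_succ _ k,
        Finset.sum_range_succ _ k, show k + 1 + 1 = k + 2 from rfl, h3]
      simp only [dotProduct_add, dotProduct_sub, dotProduct_smul, sub_dotProduct, smul_eq_mul]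
        at h1 h2 ⊢
      linarith
  have h1 := hstep N le_rfl
  have h2 := (h (N + 1) le_rfl).add_barrierDiv_le hq hq0
  have h3 := barrierDiv_nonneg hq0 (h (N + 1) le_rfl).1
  change logBarrier (p (N + 1)).1 - η * ((p (N + 1)).1 ⬝ᵥ W (N + 1))
        + barrierDiv q (p (N + 1)).1 ≤ logBarrier q - η * (q ⬝ᵥ W (N + 1)) at h2
  have h4 : q ⬝ᵥ W (N + 1) = q ⬝ᵥ v N + ∑ t ∈ Finset.range N, q ⬝ᵥ v (t + 1) := by
    rw [hW1, dotProduct_add, dotProduct_sum]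
  rw [Finset.sum_range_succ (fun t => (q - (p (t + 1)).1) ⬝ᵥ v (t + 1))]
  have h5 : ∑ t ∈ Finset.range N, (q - (p (t + 1)).1) ⬝ᵥ v (t + 1)
      = ∑ t ∈ Finset.range N, q ⬝ᵥ v (t + 1)
        - ∑ t ∈ Finset.range N, (p (t + 1)).1 ⬝ᵥ v (t + 1) := by
    simp [sub_dotProduct]
  rw [h5]
  rw [h4] at h2
  simp only [dotProduct_sub, sub_dotProduct _ _ (v (N+1)), sub_dotProduct _ _ (v N)] at h1 h2 ⊢
  linarith

end Barrier

/-! ### Existence and stability of stationary distributions -/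

section Stationary

variable {A : Type*} [Fintype A]

/-- `x` is a stationary distribution of the row-stochastic matrix with rows `Q a`. -/
def IsStationaryDist (Q : A → stdSimplex ℝ A) (x : stdSimplex ℝ A) : Prop :=
  ∀ b, ∑ a, x.1 a * (Q a).1 b = x.1 b

/-- The all-ones vector is fixed by M, so 1 - M also has a nonzero left null vector v. The triangle
inequality |v| ≤ |v| M holds in each coordinate and both sides have the same total, so |v| is itself
invariant and can be normalized. -/
theorem exists_isStationaryDist [Nonempty A] (Q : A → stdSimplex ℝ A) :
    ∃ x, IsStationaryDist Q x := by
  classical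
  set M : Matrix A A ℝ := Matrix.of fun a b => (Q a).1 b with hM
  have hdet : (1 - M).det = 0 := by
    rw [← Matrix.exists_mulVec_eq_zero_iff]
    refine ⟨fun _ => 1, fun h => ?_, ?_⟩
    · obtain ⟨a⟩ := ‹Nonempty A›
      simpa using congrFun h a
    · ext a
      rw [Matrix.sub_mulVec, Matrix.one_mulVec]
      simp [Matrix.mulVec, dotProduct, hM, (Q a).2.2]
  obtain ⟨v, hv0, hv⟩ := Matrix.exists_vecMul_eq_zero_iff.2 hdet
  have hv1 : ∀ b, ∑ a, v a * (Q a).1 b = v b := by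
    intro b
    have := congrFun hv b
    simp only [Matrix.vecMul_sub, Matrix.vecMul_one, Pi.sub_apply, Pi.zero_apply] at this
    have h2 : (Matrix.vecMul v M) b = ∑ a, v a * (Q a).1 b := rfl
    linarith
  have hle : ∀ b ∈ Finset.univ, |v b| ≤ ∑ a, |v a| * (Q a).1 b := by
    intro b _
    rw [← hv1 b]
    refine (Finset.abs_sum_le_sum_abs _ _).trans (Finset.sum_le_sum fun a _ => ?_)
    rw [abs_mul, abs_of_nonneg ((Q a).2.1 b)]
  have hsum : ∑ b, |v b| = ∑ b, ∑ a, |v a| * (Q a).1 b := by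
    rw [Finset.sum_comm]
    simp [← Finset.mul_sum, (Q _).2.2]
  have heq := (Finset.sum_eq_sum_iff_of_le hle).1 hsum
  have hS : 0 < ∑ b, |v b| := by
    obtain ⟨b, hb⟩ := Function.ne_iff.1 hv0
    exact Finset.sum_pos' (fun _ _ => abs_nonneg _) ⟨b, Finset.mem_univ _, abs_pos.2 hb⟩
  refine ⟨⟨fun b => |v b| / ∑ c, |v c|, fun b => by positivity, ?_⟩, fun b => ?_⟩
  · rw [← Finset.sum_div, div_self hS.ne']
  · simp only [div_mul_eq_mul_div]
    rw [← Finset.sum_div, ← heq b (Finset.mem_univ b)]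

theorem IsStationaryDist.pos {Q : A → stdSimplex ℝ A} {x : stdSimplex ℝ A} (h : IsStationaryDist Q x)
    (hQ : ∀ a b, 0 < (Q a).1 b) (b : A) : 0 < x.1 b := by
  rw [← h b]
  have : ∃ a, 0 < x.1 a := by
    by_contra! h0
    have := x.2.2
    rw [Finset.sum_eq_zero fun a _ => le_antisymm (h0 a) (x.2.1 a)] at this
    exact zero_ne_one this
  obtain ⟨a, ha⟩ := this
  exact Finset.sum_pos' (fun c _ => mul_nonneg (x.2.1 c) (hQ c b).le)
    ⟨a, Finset.mem_univ _, mul_pos ha (hQ a b)⟩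

/-- The `ℓ¹` distance of two mixed strategies. -/
def l1Dist (x y : stdSimplex ℝ A) : ℝ := ∑ a, |x.1 a - y.1 a|

theorem l1Dist_nonneg (x y : stdSimplex ℝ A) : 0 ≤ l1Dist x y :=
  Finset.sum_nonneg fun _ _ => abs_nonneg _

theorem l1Dist_triangle (x y z : stdSimplex ℝ A) : l1Dist x z ≤ l1Dist x y + l1Dist y z := by
  unfold l1Dist
  rw [← Finset.sum_add_distrib]
  exact Finset.sum_le_sum fun a _ => abs_sub_le _ _ _

/-- Perturbing one row by a relative error `ε` changes the ratios of the stationary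
distribution by a relative error at most `ε` with respect to the state of that row. -/
theorem l1Dist_le_of_row_perturbation {Q Q' : A → stdSimplex ℝ A} {x x' : stdSimplex ℝ A}
    (hx : IsStationaryDist Q x) (hx' : IsStationaryDist Q' x') (hQ : ∀ a b, 0 < (Q a).1 b)
    (hQ' : ∀ a b, 0 < (Q' a).1 b) {k : A} (hne : ∀ a, a ≠ k → Q' a = Q a) {ε : ℝ} (hε : 0 ≤ ε)
    (hk : ∀ b, |(Q' k).1 b - (Q k).1 b| ≤ ε * (Q k).1 b) :
    l1Dist x' x ≤ 4 * (ε / (1 + ε)) := by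
  classical
  have hp := hx.pos hQ
  have hp' := hx'.pos hQ'
  set ρ : A → ℝ := fun b => x'.1 b / x.1 b with hρ
  have hρx : ∀ b, x'.1 b = ρ b * x.1 b := fun b => (div_mul_cancel₀ _ (hp b).ne').symm
  have hρ0 : ∀ b, 0 < ρ b := fun b => div_pos (hp' b) (hp b)
  have hsplit : ∀ b, x.1 b = x.1 k * (Q k).1 b
      + ∑ a ∈ Finset.univ.erase k, x.1 a * (Q a).1 b := fun b => by
    rw [Finset.add_sum_erase _ (fun a => x.1 a * (Q a).1 b) (Finset.mem_univ k)]; exact (hx b).symm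
  have hsplit' : ∀ b, ρ b * x.1 b = ρ k * x.1 k * (Q' k).1 b
      + ∑ a ∈ Finset.univ.erase k, ρ a * (x.1 a * (Q a).1 b) := fun b => by
    rw [← hρx, ← hρx, ← hx' b, ← Finset.add_sum_erase _ _ (Finset.mem_univ k)]
    congr 1
    refine Finset.sum_congr rfl fun a ha => ?_
    rw [hne a (Finset.ne_of_mem_erase ha), hρx]; ring
  have hpk : ∀ b, 0 < x.1 k * (Q k).1 b := fun b => mul_pos (hp k) (hQ k b)
  -- Maximum principle: at a maximizer b of the ratio, the rows other than k contribute at most ρ b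
  -- times their stationary share, so this part cancels and only row k remains. The lower bound is
  -- dual.
  have hup : ∀ b, ρ b ≤ (1 + ε) * ρ k := by
    obtain ⟨b, -, hb⟩ := Finset.exists_max_image Finset.univ ρ ⟨k, Finset.mem_univ k⟩
    suffices h : ρ b ≤ (1 + ε) * ρ k from fun c => (hb c (Finset.mem_univ c)).trans h
    have h1 : ∑ a ∈ Finset.univ.erase k, ρ a * (x.1 a * (Q a).1 b)
        ≤ ρ b * ∑ a ∈ Finset.univ.erase k, x.1 a * (Q a).1 b := by
      rw [Finset.mul_sum]
      exact Finset.sum_le_sum fun a _ => mul_le_mul_of_nonneg_right (hb a (Finset.mem_univ a))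
        (mul_pos (hp a) (hQ a b)).le
    have h2 := hsplit b
    have h3 := hsplit' b
    have h4 : ρ k * x.1 k * (Q' k).1 b ≤ ρ k * x.1 k * ((1 + ε) * (Q k).1 b) :=
      mul_le_mul_of_nonneg_left (by linarith [le_of_abs_le (hk b)])
        (mul_pos (hρ0 k) (hp k)).le
    refine le_of_mul_le_mul_right ?_ (hpk b)
    have h5 : ρ b * x.1 b = ρ b * (x.1 k * (Q k).1 b)
      + ρ b * ∑ a ∈ Finset.univ.erase k, x.1 a * (Q a).1 b := by rw [← mul_add, ← h2]
    linarith
  have hlow : ∀ b, (1 - ε) * ρ k ≤ ρ b := by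
    obtain ⟨b, -, hb⟩ := Finset.exists_min_image Finset.univ ρ ⟨k, Finset.mem_univ k⟩
    suffices h : (1 - ε) * ρ k ≤ ρ b from fun c => h.trans (hb c (Finset.mem_univ c))
    have h1 : ρ b * ∑ a ∈ Finset.univ.erase k, x.1 a * (Q a).1 b
        ≤ ∑ a ∈ Finset.univ.erase k, ρ a * (x.1 a * (Q a).1 b) := by
      rw [Finset.mul_sum]
      exact Finset.sum_le_sum fun a _ => mul_le_mul_of_nonneg_right (hb a (Finset.mem_univ a))
        (mul_pos (hp a) (hQ a b)).le
    have h2 := hsplit b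
    have h3 := hsplit' b
    have h4 : ρ k * x.1 k * ((1 - ε) * (Q k).1 b) ≤ ρ k * x.1 k * (Q' k).1 b :=
      mul_le_mul_of_nonneg_left (by linarith [neg_le_of_abs_le (hk b)])
        (mul_pos (hρ0 k) (hp k)).le
    refine le_of_mul_le_mul_right ?_ (hpk b)
    have h5 : ρ b * x.1 b = ρ b * (x.1 k * (Q k).1 b)
      + ρ b * ∑ a ∈ Finset.univ.erase k, x.1 a * (Q a).1 b := by rw [← mul_add, ← h2]
    linarith
  -- The ratios average to one under x.
  have hc : 1 ≤ (1 + ε) * ρ k := by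
    calc (1 : ℝ) = ∑ b, ρ b * x.1 b := by rw [← x'.2.2]; exact Finset.sum_congr rfl fun b _ => hρx b
      _ ≤ ∑ b, (1 + ε) * ρ k * x.1 b :=
        Finset.sum_le_sum fun b _ => mul_le_mul_of_nonneg_right (hup b) (hp b).le
      _ = (1 + ε) * ρ k := by rw [← Finset.mul_sum, x.2.2, mul_one]
  have hρlow : ∀ b, 1 - 2 * (ε / (1 + ε)) ≤ ρ b := by
    intro b
    have h1 : 1 - 2 * (ε / (1 + ε)) = (1 - ε) / (1 + ε) := by field_simp; ring
    rw [h1, div_le_iff₀ (by linarith)]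
    rcases le_total ε 1 with h | h
    · nlinarith [hlow b]
    · nlinarith [hρ0 b]
  -- A lower bound on the ratios suffices: the signed differences sum to zero, so the ℓ¹ distance is
  -- twice the total negative part.
  have hpt : ∀ b, |x'.1 b - x.1 b| ≤ (x'.1 b - x.1 b) + 4 * (ε / (1 + ε)) * x.1 b := by
    intro b
    have h1 : 0 ≤ ε / (1 + ε) := by positivity
    have h2 := mul_le_mul_of_nonneg_right (hρlow b) (hp b).le
    rw [← hρx] at h2
    have h3 := mul_nonneg h1 (hp b).le
    rw [abs_le]
    constructor <;> linarith
  calc l1Dist x' x ≤ ∑ b, ((x'.1 b - x.1 b) + 4 * (ε / (1 + ε)) * x.1 b) :=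
        Finset.sum_le_sum fun b _ => hpt b
    _ = 4 * (ε / (1 + ε)) := by
        rw [Finset.sum_add_distrib, Finset.sum_sub_distrib, ← Finset.mul_sum, x.2.2, x'.2.2]; ring

/-- The largest relative change ε of the row serves in the perturbation bound, and ε / (1 + ε) is at
most twice the root of the divergence. -/
theorem l1Dist_le_sqrt_barrierDiv {Q Q' : A → stdSimplex ℝ A} {x x' : stdSimplex ℝ A}
    (hx : IsStationaryDist Q x) (hx' : IsStationaryDist Q' x') (hQ : ∀ a b, 0 < (Q a).1 b)
    (hQ' : ∀ a b, 0 < (Q' a).1 b) {k : A} (hne : ∀ a, a ≠ k → Q' a = Q a) :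
    l1Dist x' x ≤ 8 * √(barrierDiv (Q' k).1 (Q k).1) := by
  obtain ⟨b, -, hb⟩ := Finset.exists_max_image Finset.univ
    (fun b => |(Q' k).1 b / (Q k).1 b - 1|) ⟨k, Finset.mem_univ k⟩
  set ε := |(Q' k).1 b / (Q k).1 b - 1| with hε
  have hε0 : 0 ≤ ε := abs_nonneg _
  refine (l1Dist_le_of_row_perturbation hx hx' hQ hQ' hne hε0 fun c => ?_).trans ?_
  · have h1 := hb c (Finset.mem_univ c)
    have h2 : (Q' k).1 c - (Q k).1 c = ((Q' k).1 c / (Q k).1 c - 1) * (Q k).1 c := by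
      rw [sub_mul, div_mul_cancel₀ _ (hQ k c).ne', one_mul]
    rw [h2, abs_mul, abs_of_pos (hQ k c)]
    exact mul_le_mul_of_nonneg_right h1 (hQ k c).le
  · have h1 := Real.le_sqrt_of_sq_le (sq_div_one_add_le_barrierDiv (hQ' k) (hQ k) b)
    rw [← hε, Real.sqrt_mul (by norm_num), show (4 : ℝ) = 2 ^ 2 by norm_num,
      Real.sqrt_sq (by norm_num)] at h1
    linarith

/-- The stability of stationary distributions under multiplicative perturbations of the rows. -/
theorem l1Dist_sq_le_sum_barrierDiv [Nonempty A] {Q Q' : A → stdSimplex ℝ A}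
    {x x' : stdSimplex ℝ A} (hx : IsStationaryDist Q x) (hx' : IsStationaryDist Q' x')
    (hQ : ∀ a b, 0 < (Q a).1 b) (hQ' : ∀ a b, 0 < (Q' a).1 b) :
    l1Dist x' x ^ 2 ≤ 64 * Fintype.card A * ∑ a, barrierDiv (Q' a).1 (Q a).1 := by
  classical
  -- The rows are exchanged one at a time, passing through a stationary distribution of each hybrid
  -- matrix.
  have key : ∀ S : Finset A, ∀ y, IsStationaryDist (fun a => if a ∈ S then Q' a else Q a) y →
      l1Dist y x ≤ ∑ a ∈ S, 8 * √(barrierDiv (Q' a).1 (Q a).1) := by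
    intro S
    induction S using Finset.induction_on with
    | empty =>
      intro y hy
      have k : A := Classical.arbitrary A
      -- With ε = 0 the perturbation bound is uniqueness of the stationary distribution.
      simpa using l1Dist_le_of_row_perturbation (k := k) hx hy hQ (by simpa using hQ)
        (fun a _ => by simp) le_rfl (by simp)
    | insert k S hk ih =>
      intro y hy
      obtain ⟨z, hz⟩ := exists_isStationaryDist (fun a => if a ∈ S then Q' a else Q a)
      have hpos : ∀ S : Finset A, ∀ a b, 0 < ((if a ∈ S then Q' a else Q a) : stdSimplex ℝ A).1 b := by
        intro S a b
        split_ifs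
        exacts [hQ' a b, hQ a b]
      have h1 := l1Dist_le_sqrt_barrierDiv (k := k) hz hy (hpos S) (hpos (insert k S))
        (fun a ha => by simp [Finset.mem_insert, ha])
      simp only [Finset.mem_insert_self, if_true, hk, if_false] at h1
      rw [Finset.sum_insert hk]
      linarith [l1Dist_triangle y z x, ih z hz]
  have h1 := key Finset.univ x' (by simpa using hx')
  have h0 : ∀ a, 0 ≤ barrierDiv (Q' a).1 (Q a).1 := fun a => barrierDiv_nonneg (hQ' a) (hQ a)
  calc l1Dist x' x ^ 2 ≤ (∑ a, 8 * √(barrierDiv (Q' a).1 (Q a).1)) ^ 2 :=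
        pow_le_pow_left₀ (l1Dist_nonneg _ _) h1 2
    _ ≤ Fintype.card A * ∑ a, (8 * √(barrierDiv (Q' a).1 (Q a).1)) ^ 2 := by
        simpa using sq_sum_le_card_mul_sum_sq (s := Finset.univ)
          (f := fun a => 8 * √(barrierDiv (Q' a).1 (Q a).1))
    _ = _ := by
        simp only [mul_pow, Real.sq_sqrt (h0 _)]
        rw [← Finset.mul_sum]; ring

end Stationary

/-! ### Swap regret and its reduction to external regret -/

section SwapRegret

variable {A : Type*} [Fintype A]

theorem sum_Icc_one_eq_sum_range {M : Type*} [AddCommMonoid M] (f : ℕ → M) (T : ℕ) :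
    ∑ t ∈ Finset.Icc 1 T, f t = ∑ t ∈ Finset.range T, f (t + 1) := by
  induction T with
  | zero => simp
  | succ k ih => rw [Finset.sum_Icc_succ_top (by omega), ih, Finset.sum_range_succ]

theorem stdSimplex_apply_le_one {p : A → ℝ} (hp : p ∈ stdSimplex ℝ A) (a : A) : p a ≤ 1 := by
  rw [← hp.2]
  exact Finset.single_le_sum (fun b _ => hp.1 b) (Finset.mem_univ a)

theorem abs_dotProduct_le_norm {p : A → ℝ} (hp : p ∈ stdSimplex ℝ A) (w : A → ℝ) :
    |p ⬝ᵥ w| ≤ ‖w‖ := by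
  calc |p ⬝ᵥ w| ≤ ∑ a, |p a * w a| := Finset.abs_sum_le_sum_abs _ _
    _ ≤ ∑ a, p a * ‖w‖ := Finset.sum_le_sum fun a _ => by
        rw [abs_mul, abs_of_nonneg (hp.1 a)]
        exact mul_le_mul_of_nonneg_left (norm_le_pi_norm w a) (hp.1 a)
    _ = ‖w‖ := by rw [← Finset.sum_mul, hp.2, one_mul]

theorem sub_dotProduct_le_two_norm {p q : A → ℝ} (hp : p ∈ stdSimplex ℝ A)
    (hq : q ∈ stdSimplex ℝ A) (w : A → ℝ) : (p - q) ⬝ᵥ w ≤ 2 * ‖w‖ := by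
  rw [sub_dotProduct]
  linarith [le_of_abs_le (abs_dotProduct_le_norm hp w),
    neg_le_of_abs_le (abs_dotProduct_le_norm hq w)]

/-- A linear transformation of the simplex is given by a row-stochastic matrix. -/
theorem exists_rows_of_mapsTo {φ : (A → ℝ) →ₗ[ℝ] (A → ℝ)}
    (hφ : Set.MapsTo φ (stdSimplex ℝ A) (stdSimplex ℝ A)) :
    ∃ p : A → stdSimplex ℝ A, ∀ x, φ x = ∑ c, x c • (p c).1 := by
  classical
  refine ⟨fun c => ⟨φ (Pi.single c 1), hφ (single_mem_stdSimplex ℝ c)⟩, fun x => ?_⟩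
  conv_lhs => rw [pi_eq_sum_univ' x, map_sum]
  refine Finset.sum_congr rfl fun c _ => ?_
  rw [map_smul]

/-- Stationarity replaces x by the x-weighted average of its rows, so both terms become averages
over the same weights and can be compared row by row. -/
theorem sum_rows_sub_eq {Q p : A → stdSimplex ℝ A} {x : stdSimplex ℝ A}
    (hx : IsStationaryDist Q x) (u : A → ℝ) :
    ∑ a, (∑ c, x.1 c • (p c).1) a * u a - ∑ a, x.1 a * u a
      = ∑ c, ((p c).1 - (Q c).1) ⬝ᵥ (x.1 c • u) := by
  have h1 : ∑ a, x.1 a * u a = ∑ a, (∑ c, x.1 c • (Q c).1) a * u a := by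
    refine Finset.sum_congr rfl fun a _ => ?_
    rw [Finset.sum_apply]
    simp [hx a]
  have h2 : ∀ p : A → stdSimplex ℝ A, ∑ a, (∑ c, x.1 c • (p c).1) a * u a
      = ∑ c, (p c).1 ⬝ᵥ (x.1 c • u) := by
    intro p
    simp only [Finset.sum_apply, Finset.sum_mul, dotProduct, Pi.smul_apply, smul_eq_mul]
    rw [Finset.sum_comm]
    exact Finset.sum_congr rfl fun c _ => Finset.sum_congr rfl fun a _ => by ring
  rw [h1, h2, h2, ← Finset.sum_sub_distrib]
  exact Finset.sum_congr rfl fun c _ => (sub_dotProduct _ _ _).symm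

/-- The swap regret of the Blum–Mansour construction is the sum of the external regrets. -/
theorem swapRegret_le_of_stationary {x : ℕ → stdSimplex ℝ A} {u : ℕ → A → ℝ} {T : ℕ}
    {Q : ℕ → A → stdSimplex ℝ A} (hQ : ∀ t < T, IsStationaryDist (Q (t + 1)) (x (t + 1))) {B : ℝ}
    (hB : ∀ p : A → stdSimplex ℝ A, ∑ c, ∑ t ∈ Finset.range T,
      ((p c).1 - (Q (t + 1) c).1) ⬝ᵥ ((x (t + 1)).1 c • u (t + 1)) ≤ B) :
    swapRegret x u T ≤ B := by
  refine (swapRegret_isLUB x u T).2 ?_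
  rintro r ⟨φ, hφ, rfl⟩
  obtain ⟨p, hp⟩ := exists_rows_of_mapsTo hφ
  refine le_trans (le_of_eq ?_) (hB p)
  rw [← Finset.sum_sub_distrib, sum_Icc_one_eq_sum_range, Finset.sum_comm]
  refine Finset.sum_congr rfl fun t ht => ?_
  rw [hp]
  exact sum_rows_sub_eq (hQ t (Finset.mem_range.1 ht)) _

/-- The identity is an admissible map. This is what converts the regret bounds of self-play into a
bound on the path length. -/
theorem swapRegret_nonneg (x : ℕ → stdSimplex ℝ A) (u : ℕ → A → ℝ) (T : ℕ) :
    0 ≤ swapRegret x u T :=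
  (swapRegret_isLUB x u T).1 ⟨LinearMap.id, fun _ h => h, by simp⟩

theorem swapGain_round_le {φ : (A → ℝ) →ₗ[ℝ] (A → ℝ)}
    (hφ : Set.MapsTo φ (stdSimplex ℝ A) (stdSimplex ℝ A)) (x : stdSimplex ℝ A) {u : A → ℝ}
    (hu : ‖u‖ ≤ 1) : ∑ a, φ x.1 a * u a - ∑ a, x.1 a * u a ≤ 2 := by
  have h := sub_dotProduct_le_two_norm (hφ x.2) x.2 u
  rw [sub_dotProduct] at h
  exact h.trans (by linarith)

theorem swapRegret_le_two_mul (x : ℕ → stdSimplex ℝ A) {u : ℕ → A → ℝ} {T : ℕ}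
    (hu : ∀ t < T, ‖u (t + 1)‖ ≤ 1) : swapRegret x u T ≤ 2 * T := by
  refine (swapRegret_isLUB x u T).2 ?_
  rintro r ⟨φ, hφ, rfl⟩
  rw [← Finset.sum_sub_distrib, sum_Icc_one_eq_sum_range]
  calc _ ≤ ∑ _t ∈ Finset.range T, (2 : ℝ) := Finset.sum_le_sum fun t ht =>
        swapGain_round_le hφ _ (hu t (Finset.mem_range.1 ht))
    _ = 2 * T := by simp [mul_comm]

/-- Swap regret is subadditive under restarts. -/
theorem swapRegret_add_le (x : ℕ → stdSimplex ℝ A) (u : ℕ → A → ℝ) (s k : ℕ) :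
    swapRegret x u (s + k) ≤ swapRegret x u s
      + swapRegret (fun j => x (s + j)) (fun j => u (s + j)) k := by
  refine (swapRegret_isLUB x u (s + k)).2 ?_
  rintro r ⟨φ, hφ, rfl⟩
  have h1 := (swapRegret_isLUB x u s).1 ⟨φ, hφ, rfl⟩
  have h2 := (swapRegret_isLUB (fun j => x (s + j)) (fun j => u (s + j)) k).1 ⟨φ, hφ, rfl⟩
  simp only [sum_Icc_one_eq_sum_range, Finset.sum_range_add] at h1 h2 ⊢
  simp only [add_assoc] at h1 h2 ⊢
  linarith

end SwapRegret

/-! ### Regret of BM-OFTRL-LogBar with a negative path-length term -/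

section Optimistic

variable {A : Type*} [Fintype A]

/-- Half of the divergence pays for the linear term, coordinate by coordinate with z = η p[b] w[b]
and d = q[b] / p[b] - 1. The quadratic error carries p[b]² ≤ p[b], which sums to at most one, so no
dimension factor appears. -/
theorem dotProduct_sub_half_barrierDiv_le {η : ℝ} {p q w : A → ℝ} (hp : p ∈ stdSimplex ℝ A)
    (hp0 : ∀ a, 0 < p a) (hq0 : ∀ a, 0 < q a) (hη : 0 ≤ η) (hw : η * ‖w‖ ≤ 1 / 6) :
    η * ((q - p) ⬝ᵥ w) - barrierDiv q p / 2 ≤ 2 * η ^ 2 * ‖w‖ ^ 2 := by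
  have hpt : ∀ b, η * ((q b - p b) * w b) - (q b / p b - 1 - Real.log (q b / p b)) / 2
      ≤ p b * (2 * η ^ 2 * ‖w‖ ^ 2) := by
    intro b
    have hp1 := stdSimplex_apply_le_one hp b
    have hwb : |w b| ≤ ‖w‖ := norm_le_pi_norm w b
    have hz : |η * p b * w b| ≤ η * ‖w‖ := by
      rw [abs_mul, abs_of_nonneg (mul_nonneg hη (hp0 b).le)]
      have : η * p b ≤ η := mul_le_of_le_one_right hη hp1
      exact mul_le_mul this hwb (abs_nonneg _) hη
    have h1 := log_one_add_le_quadratic (hz.trans hw)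
      (show -1 < q b / p b - 1 by linarith [div_pos (hq0 b) (hp0 b)])
    have h2 : η * p b * w b * (q b / p b - 1) = η * ((q b - p b) * w b) := by
      have := (hp0 b).ne'
      field_simp
    rw [h2, add_sub_cancel] at h1
    refine h1.trans ?_
    have h3 : (η * p b * w b) ^ 2 = η ^ 2 * |w b| ^ 2 * p b ^ 2 := by rw [sq_abs]; ring
    have h4 : η ^ 2 * |w b| ^ 2 * p b ^ 2 ≤ η ^ 2 * ‖w‖ ^ 2 * p b := by
      refine mul_le_mul ?_ ?_ (by positivity) (by positivity)
      · exact mul_le_mul_of_nonneg_left (pow_le_pow_left₀ (abs_nonneg _) hwb 2) (by positivity)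
      · nlinarith [hp0 b]
    rw [h3]; linarith
  have hs := Finset.sum_le_sum fun b (_ : b ∈ Finset.univ) => hpt b
  rw [← Finset.sum_mul, hp.2, one_mul, Finset.sum_sub_distrib, ← Finset.mul_sum,
    ← Finset.sum_div] at hs
  exact hs

/-- The inequality log y ≤ y - 1 at y = m p[a]. It cancels the m log m part of the barrier of the
comparator, leaving m log T. -/
theorem card_mul_log_card_le_logBarrier [Nonempty A] {p : A → ℝ} (hp : p ∈ stdSimplex ℝ A)
    (hp0 : ∀ a, 0 < p a) : Fintype.card A * Real.log (Fintype.card A) ≤ logBarrier p := by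
  have hm : (0 : ℝ) < Fintype.card A := by exact_mod_cast Fintype.card_pos
  have h : ∑ a, Real.log (Fintype.card A * p a) ≤ ∑ a, (Fintype.card A * p a - 1) :=
    Finset.sum_le_sum fun a _ => Real.log_le_sub_one_of_pos (mul_pos hm (hp0 a))
  rw [Finset.sum_sub_distrib, ← Finset.mul_sum, hp.2] at h
  simp only [Real.log_mul hm.ne' (hp0 _).ne', Finset.sum_add_distrib, Finset.sum_const,
    Finset.card_univ, nsmul_eq_mul] at h
  unfold logBarrier
  linarith

/-- Every mixed strategy is close to one with moderate log-barrier. -/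
theorem exists_interior_comparator [Nonempty A] {T : ℝ} (hT : 1 ≤ T) (p : stdSimplex ℝ A) :
    ∃ q ∈ stdSimplex ℝ A, (∀ a, 0 < q a) ∧
      logBarrier q ≤ Fintype.card A * Real.log (T * Fintype.card A) ∧
      ∀ w, (p.1 - q) ⬝ᵥ w ≤ 2 / T * ‖w‖ := by
  have hm : (0 : ℝ) < Fintype.card A := by exact_mod_cast Fintype.card_pos
  have hT0 : 0 < T := by linarith
  set m : ℝ := (Fintype.card A : ℝ)
  set r : A → ℝ := fun _ => m⁻¹ with hr
  have hrs : r ∈ stdSimplex ℝ A := ⟨fun _ => by positivity, by simp [r, m]⟩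
  have hT1 : 0 ≤ 1 - T⁻¹ := sub_nonneg.2 (inv_le_one_of_one_le₀ hT)
  have hge : ∀ a, (T * m)⁻¹ ≤ (1 - T⁻¹) * p.1 a + T⁻¹ * r a := fun a => by
    have := mul_nonneg hT1 (p.2.1 a)
    rw [mul_inv]; simp only [hr]; linarith
  have hTm : 0 < T * m := by positivity
  -- Mixing in the uniform strategy with weight 1/T keeps every coordinate at least 1/(T m), at a
  -- cost of order 1/T per round.
  refine ⟨fun a => (1 - T⁻¹) * p.1 a + T⁻¹ * r a, ⟨fun a => ?_, ?_⟩, fun a => ?_, ?_, fun w => ?_⟩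
  · exact (inv_pos.2 hTm).le.trans (hge a)
  · rw [Finset.sum_add_distrib, ← Finset.mul_sum, ← Finset.mul_sum, p.2.2, hrs.2]; ring
  · exact (inv_pos.2 hTm).trans_le (hge a)
  · have h : ∑ _a : A, -Real.log (T * m) ≤ ∑ a, Real.log ((1 - T⁻¹) * p.1 a + T⁻¹ * r a) :=
      Finset.sum_le_sum fun a _ => by
        rw [← Real.log_inv]; exact Real.log_le_log (inv_pos.2 hTm) (hge a)
    simp only [Finset.sum_const, Finset.card_univ, nsmul_eq_mul] at h
    unfold logBarrier
    linarith
  · have h1 : p.1 - (fun a => (1 - T⁻¹) * p.1 a + T⁻¹ * r a) = T⁻¹ • (p.1 - r) := by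
      ext a; simp; ring
    rw [h1, smul_dotProduct, smul_eq_mul]
    have := mul_le_mul_of_nonneg_left (sub_dotProduct_le_two_norm p.2 hrs w) (inv_pos.2 hT0).le
    rw [div_eq_inv_mul]; linarith

/-- The regret of optimistic FTRL with the log-barrier on utilities `y⁽ᵗ⁾ u⁽ᵗ⁾`, bounded by the
variation in utilities and with a negative term. -/
theorem oftrlLogBar_scaled_regret_le [Nonempty A] {η : ℝ} (hη : 0 < η) (hη1 : η ≤ 1 / 128) {N : ℕ}
    {u : ℕ → A → ℝ} {y : ℕ → ℝ} (hu : ∀ t ≤ N + 1, ‖u t‖ ≤ 1) (hy : ∀ t, 0 ≤ y t)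
    (hy1 : ∀ t, y t ≤ 1) {p : ℕ → stdSimplex ℝ A}
    (h : ∀ t ≤ N + 1, oftrlLogBar η t (fun τ => y τ • u τ) (p t)) (q : stdSimplex ℝ A) :
    ∑ t ∈ Finset.range (N + 1), (q.1 - (p (t + 1)).1) ⬝ᵥ (y (t + 1) • u (t + 1)) ≤
      Fintype.card A * Real.log (N + 1) / η
        + 2 / (N + 1) * ∑ t ∈ Finset.range (N + 1), y (t + 1)
        + 2 * (y (N + 1) + y N)
        + 4 * η * ∑ t ∈ Finset.range N,
            (y (t + 1) * ‖u (t + 1) - u t‖ ^ 2 + (y (t + 1) - y t) ^ 2)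
        - 1 / (2 * η) * ∑ t ∈ Finset.range (N + 1), barrierDiv (p (t + 1)).1 (p t).1 := by
  set m : ℝ := (Fintype.card A : ℝ) with hm
  have hm0 : 0 < m := by rw [hm]; exact_mod_cast Fintype.card_pos
  have hN0 : (0 : ℝ) < N + 1 := by positivity
  obtain ⟨r, hr, hr0, hrlog, hrw⟩ := exists_interior_comparator (T := N + 1)
    (by linarith [(Nat.cast_nonneg N : (0 : ℝ) ≤ N)]) q
  have hv : ∀ t ≤ N + 1, ‖y t • u t‖ ≤ y t := fun t ht => by
    rw [norm_smul, Real.norm_of_nonneg (hy t)]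
    exact mul_le_of_le_one_right (hy t) (hu t ht)
  have hreg := oftrlLogBar_regret_le h hr hr0
  have hB0 : ∀ t ≤ N, 0 ≤ barrierDiv (p (t + 1)).1 (p t).1 := fun t ht =>
    barrierDiv_nonneg (h _ (by omega)).1 (h _ (by omega)).1
  have hR := card_mul_log_card_le_logBarrier (p 0).2 (h 0 (by omega)).1
  rw [Real.log_mul hN0.ne' hm0.ne'] at hrlog
  have hlast : (r - (p (N + 1)).1) ⬝ᵥ (y (N + 1) • u (N + 1) - y N • u N)
      ≤ 2 * (y (N + 1) + y N) :=
    (sub_dotProduct_le_two_norm hr (p _).2 _).trans (by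
      linarith [norm_sub_le (y (N + 1) • u (N + 1)) (y N • u N), hv _ le_rfl, hv N (by omega)])
  have hcmp : ∑ t ∈ Finset.range (N + 1), (q.1 - r) ⬝ᵥ (y (t + 1) • u (t + 1))
      ≤ 2 / (N + 1) * ∑ t ∈ Finset.range (N + 1), y (t + 1) := by
    rw [Finset.mul_sum]
    refine Finset.sum_le_sum fun t ht => (hrw _).trans ?_
    exact mul_le_mul_of_nonneg_left (hv _ (by have := Finset.mem_range.1 ht; omega))
      (by positivity)
  have hmid : ∀ t ∈ Finset.range N,
      η * (((p (t + 2)).1 - (p (t + 1)).1) ⬝ᵥ (y (t + 1) • u (t + 1) - y t • u t))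
        - barrierDiv (p (t + 2)).1 (p (t + 1)).1 / 2
      ≤ η * (4 * η * (y (t + 1) * ‖u (t + 1) - u t‖ ^ 2 + (y (t + 1) - y t) ^ 2)) := by
    intro t ht
    have htN := Finset.mem_range.1 ht
    set w := y (t + 1) • u (t + 1) - y t • u t with hw
    have hw2 : ‖w‖ ≤ 2 := by
      have := norm_sub_le (y (t + 1) • u (t + 1)) (y t • u t)
      linarith [hv (t + 1) (by omega), hv t (by omega), hy1 t, hy1 (t + 1)]
    -- The change of y u is split into a change of u and a change of y. Keeping the factor y on the
    -- first part (y² ≤ y after squaring) matters because these weights sum to one over the actions.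
    have hwn : ‖w‖ ≤ y (t + 1) * ‖u (t + 1) - u t‖ + |y (t + 1) - y t| := by
      have e : w = y (t + 1) • (u (t + 1) - u t) + (y (t + 1) - y t) • u t := by
        rw [hw]; module
      rw [e]
      refine (norm_add_le _ _).trans ?_
      rw [norm_smul, norm_smul, Real.norm_of_nonneg (hy _), Real.norm_eq_abs]
      have := mul_le_of_le_one_right (abs_nonneg (y (t + 1) - y t)) (hu t (by omega))
      linarith
    have h1 := dotProduct_sub_half_barrierDiv_le (w := w) (p (t + 1)).2 (h (t + 1) (by omega)).1
      (h (t + 2) (by omega)).1 hη.le (by nlinarith [norm_nonneg w])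
    refine h1.trans ?_
    have h2 : ‖w‖ ^ 2 ≤ 2 * (y (t + 1) * ‖u (t + 1) - u t‖ ^ 2 + (y (t + 1) - y t) ^ 2) := by
      have h3 := pow_le_pow_left₀ (norm_nonneg w) hwn 2
      have h4 := add_sq_le (a := y (t + 1) * ‖u (t + 1) - u t‖) (b := |y (t + 1) - y t|)
      rw [sq_abs] at h4
      have h5 : (y (t + 1) * ‖u (t + 1) - u t‖) ^ 2 ≤ y (t + 1) * ‖u (t + 1) - u t‖ ^ 2 := by
        rw [mul_pow]
        refine mul_le_mul_of_nonneg_right ?_ (by positivity)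
        nlinarith [hy (t + 1), hy1 (t + 1)]
      linarith
    have := mul_le_mul_of_nonneg_left h2 (show 0 ≤ 2 * η ^ 2 by positivity)
    linarith
  have hmids := Finset.sum_le_sum hmid
  rw [Finset.sum_sub_distrib, ← Finset.mul_sum, ← Finset.mul_sum, ← Finset.mul_sum,
    ← Finset.sum_div] at hmids
  -- The linear terms start with the step from round 1 to round 2, so the divergence from round 0 to
  -- round 1 is not needed to absorb them.
  have hBs : ∑ t ∈ Finset.range N, barrierDiv (p (t + 2)).1 (p (t + 1)).1
      ≤ ∑ t ∈ Finset.range (N + 1), barrierDiv (p (t + 1)).1 (p t).1 := by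
    rw [Finset.sum_range_succ']
    exact le_add_of_nonneg_right (hB0 0 (by omega))
  have hsplit : ∑ t ∈ Finset.range (N + 1), (q.1 - (p (t + 1)).1) ⬝ᵥ (y (t + 1) • u (t + 1))
      = ∑ t ∈ Finset.range (N + 1), (q.1 - r) ⬝ᵥ (y (t + 1) • u (t + 1))
      + ∑ t ∈ Finset.range (N + 1), (r - (p (t + 1)).1) ⬝ᵥ (y (t + 1) • u (t + 1)) := by
    rw [← Finset.sum_add_distrib]
    refine Finset.sum_congr rfl fun t _ => ?_
    rw [← add_dotProduct, sub_add_sub_cancel]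
  rw [hsplit]
  refine le_of_mul_le_mul_left ?_ hη
  have e1 : η * (m * Real.log (N + 1) / η) = m * Real.log (N + 1) := by field_simp
  have e2 : ∀ S : ℝ, η * (1 / (2 * η) * S) = S / 2 := fun S => by field_simp
  rw [mul_sub, mul_add, mul_add, mul_add, mul_add, e1, e2]
  have := mul_le_mul_of_nonneg_left hlast hη.le
  have := mul_le_mul_of_nonneg_left hcmp hη.le
  linarith

/-- The regret bound of BM-OFTRL-LogBar by the variation in utilities. -/
theorem oftrlLogBar_swapRegret_le [Nonempty A] {η : ℝ} (hη : 0 < η)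
    (hη1 : 16384 * Fintype.card A * η ^ 2 ≤ 1) {N : ℕ} {u : ℕ → A → ℝ} {x : ℕ → stdSimplex ℝ A}
    (hu : ∀ t ≤ N + 1, ‖u t‖ ≤ 1)
    (h : ∀ t ≤ N + 1, BlumMansourStep (oftrlLogBar η) x u t) :
    swapRegret x u (N + 1) ≤ (Fintype.card A : ℝ) ^ 2 * Real.log (N + 1) / η + 6
      + 4 * η * ∑ t ∈ Finset.range N, ‖u (t + 1) - u t‖ ^ 2
      - 1 / (256 * Fintype.card A * η)
        * ∑ t ∈ Finset.range (N + 1), l1Dist (x (t + 1)) (x t) ^ 2 := by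
  set m : ℝ := (Fintype.card A : ℝ) with hm
  have hm1 : 1 ≤ m := by rw [hm]; exact_mod_cast Fintype.card_pos
  have hη128 : η ≤ 1 / 128 := by
    by_contra! h0
    nlinarith [mul_pos hη hη]
  choose! Q hQ hQs using h
  have hQpos : ∀ t ≤ N + 1, ∀ a b, 0 < (Q t a).1 b := fun t ht a => (hQ t ht a).1
  refine swapRegret_le_of_stationary (Q := Q) (fun t ht => hQs _ (by omega)) fun p => ?_
  have hexp := Finset.sum_le_sum fun c (_ : c ∈ Finset.univ) =>
    oftrlLogBar_scaled_regret_le (p := fun t => Q t c) hη hη128 hu (fun t => (x t).2.1 c)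
      (fun t => stdSimplex_apply_le_one (x t).2 c) (fun t ht => hQ t ht c) (p c)
  refine hexp.trans ?_
  have hmass : ∀ t, ∑ c, (x t).1 c = 1 := fun t => (x t).2.2
  have e1 : ∑ c, 2 / ((N : ℝ) + 1) * ∑ t ∈ Finset.range (N + 1), (x (t + 1)).1 c = 2 := by
    rw [← Finset.mul_sum, Finset.sum_comm]
    simp only [hmass, Finset.sum_const, Finset.card_range, nsmul_eq_mul]
    push_cast
    field_simp
  have e2 : ∑ c, 2 * ((x (N + 1)).1 c + (x N).1 c) = 4 := by
    rw [← Finset.mul_sum, Finset.sum_add_distrib, hmass, hmass]; norm_num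
  have e3 : ∑ c, 4 * η * ∑ t ∈ Finset.range N, ((x (t + 1)).1 c * ‖u (t + 1) - u t‖ ^ 2
      + ((x (t + 1)).1 c - (x t).1 c) ^ 2)
      ≤ 4 * η * ∑ t ∈ Finset.range N, ‖u (t + 1) - u t‖ ^ 2
        + 4 * η * ∑ t ∈ Finset.range (N + 1), l1Dist (x (t + 1)) (x t) ^ 2 := by
    rw [← Finset.mul_sum, ← mul_add]
    refine mul_le_mul_of_nonneg_left ?_ (by positivity)
    rw [Finset.sum_comm, Finset.sum_range_succ _ N, ← add_assoc, ← Finset.sum_add_distrib]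
    refine le_add_of_le_of_nonneg (Finset.sum_le_sum fun t _ => ?_) (by positivity)
    rw [Finset.sum_add_distrib, ← Finset.sum_mul, hmass, one_mul]
    refine add_le_add le_rfl ?_
    simp only [← sq_abs ((x (t + 1)).1 _ - (x t).1 _)]
    exact Finset.sum_sq_le_sq_sum_of_nonneg fun a _ => abs_nonneg _
  have e4 : ∑ t ∈ Finset.range (N + 1), l1Dist (x (t + 1)) (x t) ^ 2
      ≤ 64 * m * ∑ c, ∑ t ∈ Finset.range (N + 1), barrierDiv (Q (t + 1) c).1 (Q t c).1 := by
    rw [Finset.sum_comm, Finset.mul_sum]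
    refine Finset.sum_le_sum fun t ht => ?_
    have := Finset.mem_range.1 ht
    exact l1Dist_sq_le_sum_barrierDiv (hQs t (by omega)) (hQs (t + 1) (by omega))
      (hQpos _ (by omega)) (hQpos _ (by omega))
  rw [Finset.sum_sub_distrib, Finset.sum_add_distrib, Finset.sum_add_distrib,
    Finset.sum_add_distrib, e1, e2, ← Finset.mul_sum (a := 1 / (2 * η))]
  set L := ∑ t ∈ Finset.range (N + 1), l1Dist (x (t + 1)) (x t) ^ 2 with hL
  have hL0 : 0 ≤ L := Finset.sum_nonneg fun t _ => sq_nonneg _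
  set D := ∑ c, ∑ t ∈ Finset.range (N + 1), barrierDiv (Q (t + 1) c).1 (Q t c).1
  have e5 : 1 / (128 * m * η) * L ≤ 1 / (2 * η) * D := by
    have : 1 / (2 * η) * D = 1 / (128 * m * η) * (64 * m * D) := by field_simp; ring
    rw [this]
    exact mul_le_mul_of_nonneg_left e4 (by positivity)
  -- The learning-rate condition lets half of the negative path-length term absorb the variation of
  -- the weights.
  have e6 : 4 * η * L ≤ 1 / (256 * m * η) * L := by
    refine mul_le_mul_of_nonneg_right ?_ hL0
    rw [le_div_iff₀ (by positivity)]
    nlinarith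
  have e7 : 1 / (128 * m * η) * L = 2 * (1 / (256 * m * η) * L) := by field_simp; ring
  have e8 : ∑ _c : A, m * Real.log (N + 1) / η = m ^ 2 * Real.log (N + 1) / η := by
    simp only [Finset.sum_const, Finset.card_univ, nsmul_eq_mul, ← hm]; ring
  rw [e8]
  linarith

end Optimistic

/-! ### Regret of BM-MWU -/

section MultiplicativeWeights

variable {A : Type*} [Fintype A]

/-- The usual potential argument with exp z ≤ 1 + z + z². The second-order term is kept proportional
to the scale y of the round; summed over the minimizers of all actions it costs only η per round. -/
theorem mwu_regret_le [Nonempty A] {η : ℝ} (hη : 0 < η) (hη1 : η ≤ 1) {v : ℕ → A → ℝ}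
    {y : ℕ → ℝ} {p : ℕ → stdSimplex ℝ A} {k : ℕ} (hy1 : ∀ t < k, y t ≤ 1)
    (hv : ∀ t < k, ‖v t‖ ≤ y t) (h : ∀ t < k, mwu η t v (p t)) (q : stdSimplex ℝ A) :
    ∑ t ∈ Finset.range k, (q.1 - (p t).1) ⬝ᵥ v t ≤
      Real.log (Fintype.card A) / η + η * ∑ t ∈ Finset.range k, y t := by
  have hm : (0 : ℝ) < Fintype.card A := by exact_mod_cast Fintype.card_pos
  set W : ℕ → ℝ := fun t => ∑ b, Real.exp (η * ∑ τ ∈ Finset.range t, v τ b) with hW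
  have hWpos : ∀ t, 0 < W t := fun t => Finset.sum_pos (fun b _ => Real.exp_pos _)
    Finset.univ_nonempty
  have hstep : ∀ t < k, W (t + 1) ≤ W t * Real.exp (η * ((p t).1 ⬝ᵥ v t) + η ^ 2 * y t) := by
    intro t ht
    have hp : ∀ b, Real.exp (η * ∑ τ ∈ Finset.range t, v τ b) = W t * (p t).1 b := fun b => by
      rw [h t ht b]; exact (mul_div_cancel₀ _ (hWpos t).ne').symm
    have h1 : W (t + 1) = W t * ∑ b, (p t).1 b * Real.exp (η * v t b) := by
      rw [Finset.mul_sum]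
      refine Finset.sum_congr rfl fun b _ => ?_
      rw [Finset.sum_range_succ, mul_add, Real.exp_add, hp, mul_assoc]
    rw [h1]
    refine mul_le_mul_of_nonneg_left ?_ (hWpos t).le
    have hy0 : 0 ≤ y t := (norm_nonneg _).trans (hv t ht)
    have h2 : ∀ b, Real.exp (η * v t b) ≤ 1 + η * v t b + η ^ 2 * y t := by
      intro b
      have hb : |v t b| ≤ y t := (norm_le_pi_norm (v t) b).trans (hv t ht)
      have hb1 : |η * v t b| ≤ 1 := by
        rw [abs_mul, abs_of_pos hη]
        exact mul_le_one₀ hη1 (abs_nonneg _) (hb.trans (hy1 t ht))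
      have h3 := le_of_abs_le (Real.abs_exp_sub_one_sub_id_le hb1)
      have h4 : (η * v t b) ^ 2 ≤ η ^ 2 * y t := by
        rw [mul_pow, ← sq_abs (v t b)]
        refine mul_le_mul_of_nonneg_left ?_ (by positivity)
        nlinarith [abs_nonneg (v t b), hy1 t ht]
      linarith
    calc ∑ b, (p t).1 b * Real.exp (η * v t b)
        ≤ ∑ b, (p t).1 b * (1 + η * v t b + η ^ 2 * y t) :=
          Finset.sum_le_sum fun b _ => mul_le_mul_of_nonneg_left (h2 b) ((p t).2.1 b)
      _ = η * ((p t).1 ⬝ᵥ v t) + η ^ 2 * y t + 1 := by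
          have : ∀ b, (p t).1 b * (1 + η * v t b + η ^ 2 * y t)
              = (p t).1 b * (1 + η ^ 2 * y t) + η * ((p t).1 b * v t b) := fun b => by ring
          simp only [this, Finset.sum_add_distrib, ← Finset.sum_mul, ← Finset.mul_sum, (p t).2.2]
          simp only [dotProduct]; ring
      _ ≤ _ := Real.add_one_le_exp _
  have hpot : ∀ j ≤ k, W j ≤ Fintype.card A *
      Real.exp (∑ t ∈ Finset.range j, (η * ((p t).1 ⬝ᵥ v t) + η ^ 2 * y t)) := by
    intro j
    induction j with
    | zero => intro _; simp [hW]
    | succ j ih =>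
      intro hj
      rw [Finset.sum_range_succ, Real.exp_add, ← mul_assoc]
      exact (hstep j (by omega)).trans
        (mul_le_mul_of_nonneg_right (ih (by omega)) (Real.exp_pos _).le)
  set E := ∑ t ∈ Finset.range k, (η * ((p t).1 ⬝ᵥ v t) + η ^ 2 * y t) with hE
  have hb : ∀ b, η * ∑ τ ∈ Finset.range k, v τ b ≤ Real.log (Fintype.card A) + E := by
    intro b
    have h1 : Real.exp (η * ∑ τ ∈ Finset.range k, v τ b) ≤ Fintype.card A * Real.exp E :=
      (Finset.single_le_sum (f := fun b => Real.exp (η * ∑ τ ∈ Finset.range k, v τ b))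
        (fun c _ => (Real.exp_pos _).le) (Finset.mem_univ b)).trans (hpot k le_rfl)
    have h2 := Real.log_le_log (Real.exp_pos _) h1
    rwa [Real.log_exp, Real.log_mul hm.ne' (Real.exp_pos _).ne', Real.log_exp] at h2
  have hq : η * ∑ t ∈ Finset.range k, q.1 ⬝ᵥ v t ≤ Real.log (Fintype.card A) + E := by
    calc η * ∑ t ∈ Finset.range k, q.1 ⬝ᵥ v t
        = ∑ b, q.1 b * (η * ∑ τ ∈ Finset.range k, v τ b) := by
          simp only [dotProduct, Finset.mul_sum]
          rw [Finset.sum_comm]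
          exact Finset.sum_congr rfl fun b _ => Finset.sum_congr rfl fun t _ => by ring
      _ ≤ ∑ b, q.1 b * (Real.log (Fintype.card A) + E) :=
          Finset.sum_le_sum fun b _ => mul_le_mul_of_nonneg_left (hb b) (q.2.1 b)
      _ = _ := by rw [← Finset.sum_mul, q.2.2, one_mul]
  simp only [sub_dotProduct, Finset.sum_sub_distrib]
  rw [hE, Finset.sum_add_distrib, ← Finset.mul_sum, ← Finset.mul_sum] at hq
  refine le_of_mul_le_mul_left ?_ hη
  rw [mul_add, mul_div_cancel₀ _ hη.ne']
  linarith

theorem mwu_swapRegret_le_of_rate_le_one [Nonempty A] {η : ℝ} (hη : 0 < η) (hη1 : η ≤ 1)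
    {u : ℕ → A → ℝ} {x : ℕ → stdSimplex ℝ A} {k : ℕ} (hu : ∀ t < k, ‖u (t + 1)‖ ≤ 1)
    (h : ∀ t < k, BlumMansourStep (mwu η) (fun j => x (j + 1)) (fun j => u (j + 1)) t) :
    swapRegret x u k ≤ Fintype.card A * Real.log (Fintype.card A) / η + η * k := by
  choose! Q hQ hQs using h
  -- Round 0 of the restarted algorithm is round 1 of the regret count.
  refine swapRegret_le_of_stationary (Q := fun t => Q (t - 1)) (fun t ht => hQs t ht) fun p => ?_
  have hexp := Finset.sum_le_sum fun c (_ : c ∈ Finset.univ) =>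
    mwu_regret_le (p := fun t => Q t c) (y := fun t => (x (t + 1)).1 c) hη hη1
      (fun t _ => stdSimplex_apply_le_one (x (t + 1)).2 c)
      (fun t ht => by
        rw [norm_smul, Real.norm_of_nonneg ((x (t + 1)).2.1 c)]
        exact mul_le_of_le_one_right ((x (t + 1)).2.1 c) (hu t ht))
      (fun t ht => hQ t ht c) (p c)
  refine hexp.trans (le_of_eq ?_)
  rw [Finset.sum_add_distrib, ← Finset.mul_sum, Finset.sum_comm]
  have : ∀ t, ∑ c, (x (t + 1)).1 c = 1 := fun t => (x (t + 1)).2.2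
  simp only [this, Finset.sum_const, Finset.card_univ, Finset.card_range, nsmul_eq_mul, mul_one]
  ring

/-- The worst-case swap regret of BM-MWU. -/
theorem mwu_swapRegret_le {T : ℕ} (hT : 1 ≤ T) (hA : 2 ≤ Fintype.card A) {u : ℕ → A → ℝ}
    {x : ℕ → stdSimplex ℝ A} {k : ℕ} (hk : k ≤ T) (hu : ∀ t < k, ‖u (t + 1)‖ ≤ 1)
    (h : ∀ t < k, BlumMansourStep (mwu (√(Fintype.card A * Real.log (Fintype.card A) / T)))
      (fun j => x (j + 1)) (fun j => u (j + 1)) t) :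
    swapRegret x u k ≤ 2 * √(Fintype.card A * Real.log (Fintype.card A) * T) := by
  have : Nonempty A := Fintype.card_pos_iff.1 (by omega)
  set G : ℝ := Fintype.card A * Real.log (Fintype.card A) with hG
  have hG0 : 0 < G := mul_pos (by positivity) (Real.log_pos (by exact_mod_cast hA))
  have hT0 : (0 : ℝ) < T := by exact_mod_cast hT
  have hkT : (k : ℝ) ≤ T := by exact_mod_cast hk
  set η := √(G / T) with hη
  have hη0 : 0 < η := Real.sqrt_pos.2 (by positivity)
  have hηT : √(G * T) = η * T := by
    rw [show G * T = G / T * T ^ 2 by field_simp, Real.sqrt_mul (by positivity),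
      Real.sqrt_sq hT0.le]
  have hηG : G / η = η * T := by
    rw [div_eq_iff hη0.ne', mul_right_comm, ← sq, hη, Real.sq_sqrt (by positivity)]
    field_simp
  rw [hηT]
  -- For a rate above one the claimed bound 2 η T already exceeds the trivial bound 2 k.
  rcases le_total η 1 with h1 | h1
  · have := mwu_swapRegret_le_of_rate_le_one hη0 h1 hu h
    rw [← hG, hηG] at this
    nlinarith
  · have := swapRegret_le_two_mul x hu
    nlinarith

end MultiplicativeWeights

/-! ### Utility vectors are bounded and Lipschitz -/

section Games

variable {n : ℕ} {A : Fin n → Type*} [∀ i, Fintype (A i)] [∀ i, DecidableEq (A i)]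

/-- Giving player i the indicator of b, which has total mass one, turns the constrained sum into a
full product sum that factorizes. -/
theorem sum_filter_prod_erase_eq (i : Fin n) (b : A i) (f : ∀ j, A j → ℝ) :
    ∑ a : (∀ j, A j) with a i = b, ∏ j ∈ Finset.univ.erase i, f j (a j)
      = ∏ j ∈ Finset.univ.erase i, ∑ c, f j c := by
  set g : ∀ j, A j → ℝ := Function.update f i (fun c => if c = b then 1 else 0) with hg
  have hgi : g i = fun c => if c = b then 1 else 0 := Function.update_self ..
  have hgj : ∀ j ∈ Finset.univ.erase i, g j = f j := fun j hj =>
    Function.update_of_ne (Finset.ne_of_mem_erase hj) ..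
  have h1 : ∏ j, ∑ c, g j c = ∑ a : (∀ j, A j), ∏ j, g j (a j) := by
    rw [Finset.prod_univ_sum, Fintype.piFinset_univ]
  rw [← Finset.mul_prod_erase _ _ (Finset.mem_univ i)] at h1
  have h2 : ∑ c, g i c = 1 := by simp [hgi]
  have h3 : ∏ j ∈ Finset.univ.erase i, ∑ c, g j c = ∏ j ∈ Finset.univ.erase i, ∑ c, f j c :=
    Finset.prod_congr rfl fun j hj => by rw [hgj j hj]
  rw [h2, one_mul, h3] at h1
  rw [h1, Finset.sum_filter]
  refine Finset.sum_congr rfl fun a _ => ?_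
  have h4 : ∏ j ∈ Finset.univ.erase i, g j (a j) = ∏ j ∈ Finset.univ.erase i, f j (a j) :=
    Finset.prod_congr rfl fun j hj => by rw [hgj j hj]
  rw [← Finset.mul_prod_erase _ _ (Finset.mem_univ i), hgi, h4]
  simp

theorem norm_utilityVector_le_one {U : Fin n → (∀ j, A j) → ℝ} (hU : ∀ i a, |U i a| ≤ 1)
    (x : ∀ j, stdSimplex ℝ (A j)) (i : Fin n) : ‖utilityVector U x i‖ ≤ 1 := by
  refine (pi_norm_le_iff_of_nonneg zero_le_one).2 fun b => ?_
  rw [Real.norm_eq_abs]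
  calc |utilityVector U x i b|
      ≤ ∑ a : (∀ j, A j) with a i = b, |U i a * ∏ j ∈ Finset.univ.erase i, (x j).1 (a j)| :=
        Finset.abs_sum_le_sum_abs _ _
    _ ≤ ∑ a : (∀ j, A j) with a i = b, ∏ j ∈ Finset.univ.erase i, (x j).1 (a j) :=
        Finset.sum_le_sum fun a _ => by
          have h0 : 0 ≤ ∏ j ∈ Finset.univ.erase i, (x j).1 (a j) :=
            Finset.prod_nonneg fun j _ => (x j).2.1 _
          rw [abs_mul, abs_of_nonneg h0]
          exact mul_le_of_le_one_left h0 (hU i a)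
    _ = 1 := by
        rw [sum_filter_prod_erase_eq i b fun j => (x j).1]
        exact Finset.prod_eq_one fun j _ => (x j).2.2

/-- Only the factor of player k changes. Bounding utilities by one leaves a product sum in which
that factor is the absolute difference and all others have mass one. -/
theorem norm_utilityVector_sub_update_le {U : Fin n → (∀ j, A j) → ℝ} (hU : ∀ i a, |U i a| ≤ 1)
    (x : ∀ j, stdSimplex ℝ (A j)) (i k : Fin n) (hk : k ≠ i) (z : stdSimplex ℝ (A k)) :
    ‖utilityVector U x i - utilityVector U (Function.update x k z) i‖ ≤ l1Dist (x k) z := by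
  refine (pi_norm_le_iff_of_nonneg (l1Dist_nonneg _ _)).2 fun b => ?_
  set f : ∀ j, A j → ℝ :=
    Function.update (fun j => (x j).1) k (fun c => |(x k).1 c - z.1 c|) with hf
  have hki : k ∈ Finset.univ.erase i := by simp [hk]
  have hfk : f k = fun c => |(x k).1 c - z.1 c| := Function.update_self ..
  have hfj : ∀ j ∈ (Finset.univ.erase i).erase k, f j = (x j).1 := fun j hj =>
    Function.update_of_ne (Finset.ne_of_mem_erase hj) ..
  rw [Pi.sub_apply, Real.norm_eq_abs]
  unfold utilityVector
  rw [← Finset.sum_sub_distrib]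
  calc _ ≤ ∑ a : (∀ j, A j) with a i = b, ∏ j ∈ Finset.univ.erase i, f j (a j) := by
        refine (Finset.abs_sum_le_sum_abs _ _).trans (Finset.sum_le_sum fun a _ => ?_)
        rw [← mul_sub, abs_mul]
        refine (mul_le_of_le_one_left (abs_nonneg _) (hU i a)).trans (le_of_eq ?_)
        rw [← Finset.mul_prod_erase _ _ hki, ← Finset.mul_prod_erase _ _ hki,
          ← Finset.mul_prod_erase _ _ hki, Function.update_self, hfk]
        have h1 : ∏ j ∈ (Finset.univ.erase i).erase k, (Function.update x k z j).1 (a j)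
            = ∏ j ∈ (Finset.univ.erase i).erase k, (x j).1 (a j) :=
          Finset.prod_congr rfl fun j hj => by
            rw [Function.update_of_ne (Finset.ne_of_mem_erase hj)]
        have h2 : ∏ j ∈ (Finset.univ.erase i).erase k, f j (a j)
            = ∏ j ∈ (Finset.univ.erase i).erase k, (x j).1 (a j) :=
          Finset.prod_congr rfl fun j hj => by rw [hfj j hj]
        rw [h1, h2, ← sub_mul, abs_mul,
          abs_of_nonneg (Finset.prod_nonneg fun j _ => (x j).2.1 (a j))]
    _ = l1Dist (x k) z := by
        rw [sum_filter_prod_erase_eq, ← Finset.mul_prod_erase _ _ hki, hfk,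
          Finset.prod_eq_one fun j hj => by rw [hfj j hj]; exact (x j).2.2]
        simp [l1Dist]

theorem utilityVector_congr (U : Fin n → (∀ j, A j) → ℝ) {x y : ∀ j, stdSimplex ℝ (A j)}
    {i : Fin n} (h : ∀ j, j ≠ i → x j = y j) : utilityVector U x i = utilityVector U y i := by
  ext b
  unfold utilityVector
  refine Finset.sum_congr rfl fun a _ => ?_
  rw [Finset.prod_congr rfl fun j hj => by rw [h j (Finset.ne_of_mem_erase hj)]]

/-- Utility vectors are Lipschitz in the strategies of the other players. -/
theorem norm_utilityVector_sub_le {U : Fin n → (∀ j, A j) → ℝ} (hU : ∀ i a, |U i a| ≤ 1)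
    (x y : ∀ j, stdSimplex ℝ (A j)) (i : Fin n) :
    ‖utilityVector U x i - utilityVector U y i‖
      ≤ ∑ j ∈ Finset.univ.erase i, l1Dist (x j) (y j) := by
  have key : ∀ S : Finset (Fin n), i ∉ S → ∀ x : ∀ j, stdSimplex ℝ (A j),
      (∀ j, j ≠ i → j ∉ S → x j = y j) →
      ‖utilityVector U x i - utilityVector U y i‖ ≤ ∑ j ∈ S, l1Dist (x j) (y j) := by
    intro S
    induction S using Finset.induction_on with
    | empty =>
      intro _ x hx
      rw [utilityVector_congr U fun j hj => hx j hj (Finset.notMem_empty j)]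
      simp
    | insert k S hkS ih =>
      intro hiS x hx
      have hki : k ≠ i := fun e => hiS (by simp [e])
      have h1 := norm_utilityVector_sub_update_le hU x i k hki (y k)
      have h2 := ih (fun hi => hiS (Finset.mem_insert_of_mem hi)) (Function.update x k (y k))
        (fun j hji hjS => by
          by_cases hjk : j = k
          · subst hjk; simp
          · rw [Function.update_of_ne hjk]; exact hx j hji (by simp [hjk, hjS]))
      have h3 : ∑ j ∈ S, l1Dist (Function.update x k (y k) j) (y j)
          = ∑ j ∈ S, l1Dist (x j) (y j) :=
        Finset.sum_congr rfl fun j hj => by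
          rw [Function.update_of_ne (ne_of_mem_of_not_mem hj hkS)]
      rw [Finset.sum_insert hkS, ← h3]
      exact (norm_sub_le_norm_sub_add_norm_sub _ _ _).trans (add_le_add h1 h2)
  exact key _ (Finset.notMem_erase i _) x fun j hji hj => absurd (by simp [hji]) hj

/-- The squared change of a utility vector is controlled by the path lengths of the others. -/
theorem norm_utilityVector_sub_sq_le {U : Fin n → (∀ j, A j) → ℝ} (hU : ∀ i a, |U i a| ≤ 1)
    (x y : ∀ j, stdSimplex ℝ (A j)) (i : Fin n) :
    ‖utilityVector U x i - utilityVector U y i‖ ^ 2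
      ≤ ((n : ℝ) - 1) * ∑ j ∈ Finset.univ.erase i, l1Dist (x j) (y j) ^ 2 := by
  refine (pow_le_pow_left₀ (norm_nonneg _) (norm_utilityVector_sub_le hU x y i) 2).trans ?_
  refine sq_sum_le_card_mul_sum_sq.trans (le_of_eq ?_)
  rw [Finset.card_erase_of_mem (Finset.mem_univ i), Finset.card_univ, Fintype.card_fin,
    Nat.cast_sub (by have := i.2; omega), Nat.cast_one]

end Games

/-! ### Existence of a learner following the adaptive dynamics -/

section Construction

variable {A : Type*} [Fintype A]

/-- The rule of round `t` depends on the utilities of the earlier rounds only. -/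
def UpdateRule.IsCausal (R : UpdateRule A) : Prop :=
  ∀ t v v' p, (∀ τ < t, v τ = v' τ) → R t v p → R t v' p

theorem oftrlLogBar_isCausal (η : ℝ) : (oftrlLogBar (A := A) η).IsCausal := by
  intro t v v' p hv h
  unfold oftrlLogBar at h ⊢
  have h1 : ∑ τ ∈ Finset.Ico 1 t, v τ = ∑ τ ∈ Finset.Ico 1 t, v' τ :=
    Finset.sum_congr rfl fun τ hτ => hv τ (Finset.mem_Ico.1 hτ).2
  rcases Nat.eq_zero_or_pos t with rfl | ht
  · simpa using h
  · rwa [h1, hv (t - 1) (by omega)] at h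

theorem mwu_isCausal (η : ℝ) : (mwu (A := A) η).IsCausal := by
  intro t v v' p hv h b
  have h1 : ∀ c, ∑ τ ∈ Finset.range t, v' τ c = ∑ τ ∈ Finset.range t, v τ c := fun c =>
    Finset.sum_congr rfl fun τ hτ => by rw [hv τ (Finset.mem_range.1 hτ)]
  simp only [h1]
  exact h b

theorem exists_mwu [Nonempty A] (η : ℝ) (t : ℕ) (v : ℕ → A → ℝ) : ∃ p, mwu η t v p := by
  have hpos : 0 < ∑ c, Real.exp (η * ∑ τ ∈ Finset.range t, v τ c) :=
    Finset.sum_pos (fun b _ => Real.exp_pos _) Finset.univ_nonempty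
  refine ⟨⟨fun b => Real.exp (η * ∑ τ ∈ Finset.range t, v τ b) /
    ∑ c, Real.exp (η * ∑ τ ∈ Finset.range t, v τ c), fun b => by positivity, ?_⟩, fun b => rfl⟩
  rw [← Finset.sum_div, div_self hpos.ne']

/-- `z` is a possible strategy of the Blum–Mansour algorithm in round `t`. -/
def IsBlumMansourStrategy (R : UpdateRule A) (x : ℕ → stdSimplex ℝ A) (u : ℕ → A → ℝ) (t : ℕ)
    (z : stdSimplex ℝ A) : Prop :=
  ∃ Q : A → stdSimplex ℝ A, (∀ a, R t (fun τ => (x τ).1 a • u τ) (Q a)) ∧ IsStationaryDist Q z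

theorem exists_isBlumMansourStrategy [Nonempty A] {R : UpdateRule A} (hR : ∀ t v, ∃ p, R t v p)
    (x : ℕ → stdSimplex ℝ A) (u : ℕ → A → ℝ) (t : ℕ) : ∃ z, IsBlumMansourStrategy R x u t z := by
  choose Q hQ using fun a => hR t (fun τ => (x τ).1 a • u τ)
  obtain ⟨z, hz⟩ := exists_isStationaryDist Q
  exact ⟨z, Q, hQ, hz⟩

/-- A recursively built learner sees only a truncated history; causality transfers its step to the
full sequences. -/
theorem IsBlumMansourStrategy.blumMansourStep {R : UpdateRule A} (hR : R.IsCausal)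
    {x x' : ℕ → stdSimplex ℝ A} {u u' : ℕ → A → ℝ} {t : ℕ}
    (h : IsBlumMansourStrategy R x u t (x' t)) (hx : ∀ τ < t, x τ = x' τ)
    (hu : ∀ τ < t, u τ = u' τ) : BlumMansourStep R x' u' t := by
  obtain ⟨Q, hQ, hz⟩ := h
  exact ⟨Q, fun a => hR _ _ _ _ (fun τ hτ => by rw [hx τ hτ, hu τ hτ]) (hQ a), hz⟩

theorem variationExceeds_congr {C : ℝ} {u u' : ℕ → A → ℝ} {s : ℕ} (h : ∀ τ ≤ s, u τ = u' τ) :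
    VariationExceeds C u s ↔ VariationExceeds C u' s := by
  unfold VariationExceeds
  rw [Finset.sum_congr rfl fun τ hτ => by
    rw [h τ (Finset.mem_Icc.1 hτ).2, h (τ - 1) (by have := (Finset.mem_Icc.1 hτ).2; omega)]]

/-- `z` is a possible strategy of the adaptive dynamics in round `t`. -/
def IsAdaptiveStrategy (η C η' : ℝ) (t : ℕ) (x : ℕ → stdSimplex ℝ A) (u : ℕ → A → ℝ)
    (z : stdSimplex ℝ A) : Prop :=
  ((∀ s < t, ¬ VariationExceeds C u s) → IsBlumMansourStrategy (oftrlLogBar η) x u t z) ∧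
    ∀ s k, t = s + 1 + k → VariationExceeds C u s → (∀ r < s, ¬ VariationExceeds C u r) →
      IsBlumMansourStrategy (mwu η') (fun j => x (s + 1 + j)) (fun j => u (s + 1 + j)) k z

theorem exists_isAdaptiveStrategy [Nonempty A] (η C η' : ℝ) (t : ℕ) (x : ℕ → stdSimplex ℝ A)
    (u : ℕ → A → ℝ) : ∃ z, IsAdaptiveStrategy η C η' t x u z := by
  classical
  by_cases h : ∀ s < t, ¬ VariationExceeds C u s
  · obtain ⟨z, hz⟩ := exists_isBlumMansourStrategy (R := oftrlLogBar η)
      (fun _ _ => exists_isBarrierArgmax _ _) x u t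
    exact ⟨z, fun _ => hz, fun s k hk hs _ => absurd hs (h s (by omega))⟩
  · push Not at h
    set s := Nat.find h with hs
    obtain ⟨hst, hsV⟩ := Nat.find_spec h
    obtain ⟨k, hk⟩ := Nat.exists_eq_add_of_le (Nat.succ_le_of_lt hst)
    obtain ⟨z, hz⟩ := exists_isBlumMansourStrategy (R := mwu η') (exists_mwu η')
      (fun j => x (s + 1 + j)) (fun j => u (s + 1 + j)) k
    refine ⟨z, fun h' => absurd hsV (h' _ hst), fun s' k' hk' hs' hmin => ?_⟩
    -- The first failure is unique, so the requirement after a switch concerns just one pair (s, k).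
    have h1 : s' = s := by
      refine le_antisymm (not_lt.1 fun hlt => hmin s hlt hsV) ?_
      exact Nat.find_min' h ⟨by omega, hs'⟩
    have h2 : k' = k := by
      have : t = s + 1 + k := hk
      omega
    rw [h1, h2]
    exact hz

/-- A learner that follows the adaptive dynamics. -/
noncomputable def adaptiveLearner [Nonempty A] (η C η' : ℝ) (t : ℕ) (h : Fin t → A → ℝ) :
    stdSimplex ℝ A :=
  (exists_isAdaptiveStrategy η C η' t
    (fun s => if hs : s < t then
        adaptiveLearner η C η' s fun r => h ⟨r, r.2.trans hs⟩
      -- Filler for rounds from t on; by causality these values play no role.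
      else (exists_isStationaryDist fun _ => (exists_mwu (A := A) 0 0 0).choose).choose)
    (fun s => if hs : s < t then h ⟨s, hs⟩ else 0)).choose
termination_by t

theorem adaptiveLearner_isAdaptiveDynamics [Nonempty A] (η C η' : ℝ) :
    IsAdaptiveDynamics η C η' (adaptiveLearner (A := A) η C η') := by
  have key : ∀ (u : ℕ → A → ℝ) (t : ℕ), ∃ x' u',
      (∀ s < t, x' s = Learner.run (adaptiveLearner η C η') u s) ∧ (∀ s < t, u' s = u s) ∧
      IsAdaptiveStrategy η C η' t x' u' (Learner.run (adaptiveLearner η C η') u t) := by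
    intro u t
    unfold Learner.run
    rw [adaptiveLearner]
    refine ⟨_, _, fun s hs => ?_, fun s hs => ?_,
      Exists.choose_spec (exists_isAdaptiveStrategy η C η' t _ _)⟩
    · simp [hs]
    · simp [hs]
  intro u
  refine ⟨fun t ht => ?_, fun s hs k => ?_⟩
  · obtain ⟨x', u', hx, hu, h, -⟩ := key u t
    refine IsBlumMansourStrategy.blumMansourStep (oftrlLogBar_isCausal η) (h fun s hs => ?_) hx hu
    rw [variationExceeds_congr fun τ hτ => hu τ (by omega)]
    exact ht s hs
  · obtain ⟨x', u', hx, hu, -, h⟩ := key u (s + 1 + k)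
    refine IsBlumMansourStrategy.blumMansourStep (mwu_isCausal η') (h s k rfl ?_ fun r hr => ?_)
      (fun τ hτ => hx _ (by omega)) (fun τ hτ => hu _ (by omega))
    · rw [variationExceeds_congr fun τ hτ => hu τ (by omega)]
      exact hs.1
    · rw [variationExceeds_congr fun τ hτ => hu τ (by omega)]
      exact fun h' => absurd (hs.2 h') (by omega)

end Construction

/-! ### Constants, the adversarial guarantee and self-play -/

section Dynamics

variable {n : ℕ} {A : Fin n → Type*} [∀ i, Fintype (A i)]

theorem card_le_maxActions (i : Fin n) : (Fintype.card (A i) : ℝ) ≤ maxActions A := by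
  exact_mod_cast Finset.le_sup (f := fun j => Fintype.card (A j)) (Finset.mem_univ i)

theorem two_le_maxActions (hA : ∀ i, 2 ≤ Fintype.card (A i)) (i : Fin n) :
    (2 : ℝ) ≤ maxActions A :=
  (by exact_mod_cast hA i : (2 : ℝ) ≤ Fintype.card (A i)).trans (card_le_maxActions i)

theorem four_mul_le_sumSqActions (hA : ∀ i, 2 ≤ Fintype.card (A i)) :
    (4 : ℝ) * n ≤ sumSqActions A := by
  have h : ∑ _j : Fin n, 4 ≤ sumSqActions A :=
    Finset.sum_le_sum fun j _ => Nat.pow_le_pow_left (hA j) 2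
  simp only [Finset.sum_const, Finset.card_univ, Fintype.card_fin, smul_eq_mul] at h
  have h' : ((n * 4 : ℕ) : ℝ) ≤ sumSqActions A := by exact_mod_cast h
  push_cast at h'; linarith

theorem one_le_natCast_sub_one (hn : 2 ≤ n) : (1 : ℝ) ≤ (n : ℝ) - 1 := by
  have : (2 : ℝ) ≤ n := by exact_mod_cast hn
  linarith

theorem oftrlRate_pos (hn : 2 ≤ n) (hA : ∀ i, 2 ≤ Fintype.card (A i)) (i : Fin n) :
    0 < oftrlRate A := by
  have h1 := one_le_natCast_sub_one hn
  have h2 := two_le_maxActions hA i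
  have h3 : 0 < √(maxActions A : ℝ) := Real.sqrt_pos.2 (by linarith)
  unfold oftrlRate
  positivity

theorem div_oftrlRate (r : ℝ) :
    r / oftrlRate A = r * (128 * ((n : ℝ) - 1) * √(maxActions A)) := by
  unfold oftrlRate
  rw [one_div, div_inv_eq_mul]

theorem oftrlRate_sq_mul (hn : 2 ≤ n) (hA : ∀ i, 2 ≤ Fintype.card (A i)) (i : Fin n) :
    oftrlRate A ^ 2 * (16384 * ((n : ℝ) - 1) ^ 2 * maxActions A) = 1 := by
  have h1 := one_le_natCast_sub_one hn
  have h2 := two_le_maxActions hA i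
  have h4 : 0 < √(maxActions A : ℝ) := Real.sqrt_pos.2 (by linarith)
  have h3 : (16384 : ℝ) * ((n : ℝ) - 1) ^ 2 * maxActions A
      = (128 * ((n : ℝ) - 1) * √(maxActions A)) ^ 2 := by
    rw [mul_pow, mul_pow, Real.sq_sqrt (by linarith)]; norm_num
  rw [h3, ← mul_pow]
  unfold oftrlRate
  rw [one_div_mul_cancel (by positivity), one_pow]

/-- The threshold is calibrated so that the variation term of the regret bound becomes exactly the
second summand of the logarithmic bound. -/
theorem oftrlRate_mul_variationConst (hn : 2 ≤ n) (hA : ∀ i, 2 ≤ Fintype.card (A i)) (i : Fin n) :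
    4 * oftrlRate A * variationConst A = 256 * √(maxActions A) * sumSqActions A := by
  have h1 := one_le_natCast_sub_one hn
  have h2 := two_le_maxActions hA i
  have h4 : 0 < √(maxActions A : ℝ) := Real.sqrt_pos.2 (by linarith)
  have h5 : (maxActions A : ℝ) = √(maxActions A) ^ 2 := (Real.sq_sqrt (by linarith)).symm
  unfold oftrlRate variationConst
  nth_rewrite 2 [h5]
  have : (n : ℝ) - 1 ≠ 0 := by linarith
  field_simp
  ring

theorem card_mul_oftrlRate_sq_le (hn : 2 ≤ n) (hA : ∀ i, 2 ≤ Fintype.card (A i)) (i : Fin n) :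
    16384 * (Fintype.card (A i) : ℝ) * oftrlRate A ^ 2 ≤ 1 := by
  have h1 := one_le_natCast_sub_one hn
  have h2 := card_le_maxActions (A := A) i
  have h3 : (Fintype.card (A i) : ℝ) ≤ ((n : ℝ) - 1) ^ 2 * maxActions A := by
    exact h2.trans (le_mul_of_one_le_left (Nat.cast_nonneg _) (one_le_pow₀ h1))
  rw [← oftrlRate_sq_mul hn hA i]
  nlinarith [sq_nonneg (oftrlRate A)]

theorem half_le_log_of_two_le {T : ℕ} (hT : 2 ≤ T) : (1 / 2 : ℝ) ≤ Real.log T := by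
  have h1 : Real.log 2 ≤ Real.log T :=
    Real.log_le_log (by norm_num) (by exact_mod_cast hT)
  linarith [Real.log_two_gt_d9]

theorem four_le_variationConst_mul_log (hn : 2 ≤ n) (hA : ∀ i, 2 ≤ Fintype.card (A i))
    (i : Fin n) {T : ℕ} (hT : 2 ≤ T) : 4 ≤ variationConst A * Real.log T := by
  have h1 := one_le_natCast_sub_one hn
  have h2 := two_le_maxActions hA i
  have h3 := four_mul_le_sumSqActions hA
  have h4 := half_le_log_of_two_le hT
  have h5 : (8 : ℝ) ≤ variationConst A := by
    unfold variationConst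
    have a1 : (8 : ℝ) * 1 ≤ 8192 * ((n : ℝ) - 1) := by linarith
    have a2 := mul_le_mul a1 (show (1 : ℝ) ≤ maxActions A by linarith) zero_le_one (by linarith)
    have a3 := mul_le_mul a2 (show (1 : ℝ) ≤ sumSqActions A by linarith) zero_le_one
      (by positivity)
    linarith
  nlinarith

/-- The test starts in round 2, so N = 1 is covered by the trivial variation bound 4. Regret up to N
+ 1 needs the variation only up to N; hence the round in which the test first fails is still
covered. -/
theorem variation_le_of_not_variationExceeds (hn : 2 ≤ n) (hA : ∀ i, 2 ≤ Fintype.card (A i))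
    {i : Fin n} {u : ℕ → A i → ℝ} {N : ℕ} (hN : 1 ≤ N) (hu : ∀ t ≤ N, ‖u t‖ ≤ 1)
    (h : ¬ VariationExceeds (variationConst A) u N) :
    ∑ t ∈ Finset.range N, ‖u (t + 1) - u t‖ ^ 2
      ≤ variationConst A * Real.log (N + 1 : ℕ) := by
  have hC := four_le_variationConst_mul_log hn hA i (T := N + 1) (by omega)
  rcases Nat.lt_or_ge N 2 with h2 | h2
  · obtain rfl : N = 1 := by omega
    refine le_trans ?_ hC
    have h3 := norm_sub_le (u 1) (u 0)
    have h4 := hu 1 le_rfl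
    have h5 := hu 0 (by omega)
    simp only [Finset.range_one, Finset.sum_singleton, zero_add]
    nlinarith [norm_nonneg (u 1 - u 0)]
  · unfold VariationExceeds at h
    rw [sum_Icc_one_eq_sum_range] at h
    push Not at h
    refine (h h2).trans (mul_le_mul_of_nonneg_left ?_ ?_)
    · exact Real.log_le_log (by positivity) (by push_cast; linarith)
    · have h1 := one_le_natCast_sub_one hn
      unfold variationConst
      positivity

theorem logRegretBound_mono (hn : 2 ≤ n) (i : Fin n) {S T : ℕ} (hS : 1 ≤ S) (hST : S ≤ T) :
    logRegretBound A i S ≤ logRegretBound A i T := by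
  have h1 := one_le_natCast_sub_one hn
  unfold logRegretBound
  refine mul_le_mul_of_nonneg_left ?_ (by positivity)
  exact Real.log_le_log (by positivity) (by exact_mod_cast hST)

/-- While the test of the variation succeeds, the swap regret is logarithmic. -/
theorem IsAdaptiveDynamics.swapRegret_le_logRegretBound (hn : 2 ≤ n)
    (hA : ∀ i, 2 ≤ Fintype.card (A i)) {i : Fin n} {η' : ℝ} {D : Learner (A i)}
    (hD : IsAdaptiveDynamics (oftrlRate A) (variationConst A) η' D) {u : ℕ → A i → ℝ} {T : ℕ}
    (hT : 2 ≤ T) (hu : ∀ t ≤ T, ‖u t‖ ≤ 1)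
    (h : ∀ s < T, ¬ VariationExceeds (variationConst A) u s) :
    swapRegret (D.run u) u T ≤ logRegretBound A i T := by
  have : Nonempty (A i) := Fintype.card_pos_iff.1 (by have := hA i; omega)
  obtain ⟨N, rfl⟩ : ∃ N, T = N + 1 := ⟨T - 1, by omega⟩
  have hη := oftrlRate_pos hn hA i
  have h1 := oftrlLogBar_swapRegret_le hη (card_mul_oftrlRate_sq_le hn hA i) hu
    (x := D.run u) (fun t ht => (hD u).1 t fun s hs => h s (by omega))
  have h2 := variation_le_of_not_variationExceeds hn hA (by omega)
    (fun t ht => hu t (by omega)) (h N (by omega))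
  have h3 := mul_le_mul_of_nonneg_left h2 (show 0 ≤ 4 * oftrlRate A by positivity)
  rw [← mul_assoc, oftrlRate_mul_variationConst hn hA i] at h3
  have h4 : 0 ≤ 1 / (256 * (Fintype.card (A i) : ℝ) * oftrlRate A) *
      ∑ t ∈ Finset.range (N + 1), l1Dist (D.run u (t + 1)) (D.run u t) ^ 2 := by positivity
  have hl := half_le_log_of_two_le hT
  have hκ := one_le_natCast_sub_one hn
  have hM : (1 : ℝ) ≤ √(maxActions A) := Real.one_le_sqrt.2 (by linarith [two_le_maxActions hA i])
  have hm : (1 : ℝ) ≤ (Fintype.card (A i) : ℝ) ^ 2 :=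
    one_le_pow₀ (by exact_mod_cast (by have := hA i; omega : 1 ≤ Fintype.card (A i)))
  rw [div_oftrlRate] at h1
  rw [show ((N : ℝ) + 1) = ((N + 1 : ℕ) : ℝ) by push_cast; rfl] at h1
  set l := Real.log ((N + 1 : ℕ) : ℝ)
  -- The additive constant is absorbed by doubling 128 to 256 in the first summand.
  have h6 : 6 ≤ (Fintype.card (A i) : ℝ) ^ 2 * l * (128 * ((n : ℝ) - 1) * √(maxActions A)) := by
    have a1 : (1 : ℝ) * (1 / 2) ≤ (Fintype.card (A i) : ℝ) ^ 2 * l :=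
      mul_le_mul hm hl (by norm_num) (by linarith)
    have a2 : (128 : ℝ) * 1 * 1 ≤ 128 * ((n : ℝ) - 1) * √(maxActions A) :=
      mul_le_mul (by linarith) hM zero_le_one (by linarith)
    have a3 := mul_le_mul a1 a2 (by norm_num) (by linarith)
    linarith
  unfold logRegretBound
  linarith

/-- The adversarial guarantee of the adaptive dynamics. -/
theorem IsAdaptiveDynamics.swapRegret_le_adversarial (hn : 2 ≤ n)
    (hA : ∀ i, 2 ≤ Fintype.card (A i)) {i : Fin n} {T : ℕ} (hT : 1 ≤ T) {D : Learner (A i)}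
    (hD : IsAdaptiveDynamics (oftrlRate A) (variationConst A)
      (√(Fintype.card (A i) * Real.log (Fintype.card (A i)) / T)) D) {u : ℕ → A i → ℝ}
    (hu : ∀ t ≤ T, ‖u t‖ ≤ 1) :
    swapRegret (D.run u) u T ≤ logRegretBound A i T
      + 2 * √(Fintype.card (A i) * Real.log (Fintype.card (A i)) * T) + 2 := by
  classical
  have hsq := Real.sqrt_nonneg (Fintype.card (A i) * Real.log (Fintype.card (A i)) * T)
  by_cases h : ∃ s, s < T ∧ VariationExceeds (variationConst A) u s
  · set s := Nat.find h with hs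
    obtain ⟨hsT, hsV⟩ := Nat.find_spec h
    have hmin : ∀ r < s, ¬ VariationExceeds (variationConst A) u r := fun r hr hr' =>
      Nat.find_min h hr ⟨by omega, hr'⟩
    have hleast : IsLeast {r | VariationExceeds (variationConst A) u r} s :=
      ⟨hsV, fun r hr => not_lt.1 fun hlt => hmin r hlt hr⟩
    obtain ⟨k, hk⟩ : ∃ k, T = s + k := Nat.exists_eq_add_of_le hsT.le
    have h1 := hD.swapRegret_le_logRegretBound hn hA hsV.1 (fun t ht => hu t (by omega)) hmin
    have h2 := mwu_swapRegret_le hT (hA i) (u := fun j => u (s + j))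
      (x := fun j => D.run u (s + j)) (k := k) (by omega) (fun t ht => hu _ (by omega))
      (fun t _ => by
        have := (hD u).2 s hleast t
        simpa only [add_assoc, add_comm 1] using this)
    have h3 := swapRegret_add_le (D.run u) u s k
    rw [← hk] at h3
    have h4 := logRegretBound_mono (A := A) hn i (by have := hsV.1; omega) hsT.le
    linarith
  · push Not at h
    rcases Nat.lt_or_ge T 2 with hT2 | hT2
    -- Here log T = 0, and the additive 2 of the claim pays for the single round; no other case uses
    -- it.
    · obtain rfl : T = 1 := by omega
      have h1 := swapRegret_le_two_mul (D.run u) (T := 1) (u := u) (fun t ht => hu _ (by omega))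
      have h2 : logRegretBound A i 1 = 0 := by simp [logRegretBound]
      rw [h2]
      push_cast at h1 hsq ⊢
      linarith
    · linarith [hD.swapRegret_le_logRegretBound hn hA hT2 hu h]

variable [∀ i, DecidableEq (A i)]

theorem play_eq_run (U : Fin n → (∀ j, A j) → ℝ) (D : ∀ i, Learner (A i)) (t : ℕ) (i : Fin n) :
    play U D t i = (D i).run (fun s => utilityVector U (play U D s) i) t := by
  rw [play]
  rfl

/-- In self-play the variation of the utilities is always logarithmic. -/
theorem not_variationExceeds_play (hn : 2 ≤ n) (hA : ∀ i, 2 ≤ Fintype.card (A i))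
    {η' : Fin n → ℝ} {D : ∀ i, Learner (A i)}
    (hD : ∀ i, IsAdaptiveDynamics (oftrlRate A) (variationConst A) (η' i) (D i))
    {U : Fin n → (∀ j, A j) → ℝ} (hU : ∀ i a, |U i a| ≤ 1) (t : ℕ) (i : Fin n) :
    ¬ VariationExceeds (variationConst A) (fun s => utilityVector U (play U D s) i) t := by
  induction t using Nat.strong_induction_on generalizing i with
  | _ t ih =>
  rintro ⟨ht2, ht⟩
  refine absurd ht (not_lt.2 ?_)
  obtain ⟨N, rfl⟩ : ∃ N, t = N + 1 := ⟨t - 1, by omega⟩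
  set u : ∀ i, ℕ → A i → ℝ := fun i s => utilityVector U (play U D s) i with hu
  set l := Real.log ((N + 1 : ℕ) : ℝ) with hl
  set L : Fin n → ℝ := fun j => ∑ τ ∈ Finset.range (N + 1),
    l1Dist (play U D (τ + 1) j) (play U D τ j) ^ 2 with hL
  set η := oftrlRate A with hηd
  set M : ℝ := (maxActions A : ℝ) with hM
  set S : ℝ := (sumSqActions A : ℝ) with hS
  have hη : 0 < η := oftrlRate_pos hn hA i
  have hM2 : 2 ≤ M := two_le_maxActions hA i
  have hκ := one_le_natCast_sub_one hn
  have hl2 : 1 / 2 ≤ l := half_le_log_of_two_le ht2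
  have hL0 : ∀ j, 0 ≤ L j := fun j => Finset.sum_nonneg fun τ _ => sq_nonneg _
  have hvar : ∀ i, ∑ τ ∈ Finset.range (N + 1), ‖u i (τ + 1) - u i τ‖ ^ 2
      ≤ ((n : ℝ) - 1) * ∑ j ∈ Finset.univ.erase i, L j := by
    intro i
    rw [hL, Finset.sum_comm, Finset.mul_sum]
    exact Finset.sum_le_sum fun τ _ => norm_utilityVector_sub_sq_le hU _ _ i
  -- By the induction hypothesis every player still runs optimistic FTRL through round N + 1, so the
  -- regret bound applies to all of them. Passing from m_i to the maximum gives all path lengths the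
  -- same coefficient.
  have hreg : ∀ i, 0 ≤ (Fintype.card (A i) : ℝ) ^ 2 * l / η + 6
      + 4 * η * (((n : ℝ) - 1) * (∑ j, L j - L i)) - 1 / (256 * M * η) * L i := by
    intro i
    have : Nonempty (A i) := Fintype.card_pos_iff.1 (by have := hA i; omega)
    have h1 := oftrlLogBar_swapRegret_le (u := u i) (x := fun t => play U D t i) (N := N) hη
      (card_mul_oftrlRate_sq_le hn hA i) (fun t _ => norm_utilityVector_le_one hU _ i)
      (fun t ht => by
        have := (hD i (u i)).1 t fun s hs => ih s (by omega) i
        rwa [show (fun t => play U D t i) = (D i).run (u i) from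
          funext fun t => play_eq_run U D t i])
    have h0 := swapRegret_nonneg (fun t => play U D t i) (u i) (N + 1)
    have h2 : ∑ τ ∈ Finset.range N, ‖u i (τ + 1) - u i τ‖ ^ 2
        ≤ ((n : ℝ) - 1) * (∑ j, L j - L i) := by
      rw [← Finset.sum_erase_eq_sub (Finset.mem_univ i)]
      refine le_trans ?_ (hvar i)
      rw [Finset.sum_range_succ]
      exact le_add_of_nonneg_right (sq_nonneg _)
    have h3 := mul_le_mul_of_nonneg_left h2 (show 0 ≤ 4 * η by positivity)
    have h4 : 1 / (256 * M * η) * L i ≤ 1 / (256 * Fintype.card (A i) * η) * L i := by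
      refine mul_le_mul_of_nonneg_right ?_ (hL0 i)
      have hm : (0 : ℝ) < Fintype.card (A i) := by exact_mod_cast Fintype.card_pos
      refine one_div_le_one_div_of_le (by positivity) ?_
      gcongr
      exact card_le_maxActions i
    rw [show ((N : ℝ) + 1) = ((N + 1 : ℕ) : ℝ) by push_cast; rfl] at h1
    linarith
  have hsum := Finset.sum_nonneg fun i (_ : i ∈ Finset.univ) => hreg i
  set P := ∑ j, L j with hP
  have hP0 : 0 ≤ P := Finset.sum_nonneg fun j _ => hL0 j
  have e1 : ∑ i, (Fintype.card (A i) : ℝ) ^ 2 * l / η = S * l / η := by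
    rw [← Finset.sum_div, ← Finset.sum_mul, hS]
    simp [sumSqActions]
  rw [Finset.sum_sub_distrib, Finset.sum_add_distrib, Finset.sum_add_distrib, e1,
    ← Finset.mul_sum, ← Finset.mul_sum, ← Finset.mul_sum, Finset.sum_sub_distrib, ← hP] at hsum
  simp only [Finset.sum_const, Finset.card_univ, Fintype.card_fin, nsmul_eq_mul] at hsum
  have hsq := oftrlRate_sq_mul hn hA i
  have hS4 := four_mul_le_sumSqActions hA
  have hη1 : η ≤ 1 / 128 := by
    by_contra! h0
    have a1 : (2 : ℝ) ≤ ((n : ℝ) - 1) ^ 2 * M := by nlinarith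
    nlinarith [mul_pos hη hη]
  have h5 : 0 ≤ η * M * (S * l / η + n * 6 + 4 * η * (((n : ℝ) - 1) * (n * P - P))
      - 1 / (256 * M * η) * P) := mul_nonneg (by positivity) hsum
  -- The choice of η makes the bracket equal to one: the positive feedback among the players is P /
  -- 4096 against the negative P / 256.
  have h6 : η * M * (S * l / η + n * 6 + 4 * η * (((n : ℝ) - 1) * (n * P - P))
      - 1 / (256 * M * η) * P)
      = M * (S * l + 6 * n * η) + (η ^ 2 * (16384 * ((n : ℝ) - 1) ^ 2 * M)) * P / 4096 - P / 256 := by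
    field_simp
    ring
  rw [h6, hsq, one_mul] at h5
  have h7 : 6 * n * η ≤ S * l := by
    have a1 : 6 * (n : ℝ) * η ≤ 6 * n * (1 / 128) :=
      mul_le_mul_of_nonneg_left hη1 (by positivity)
    have a2 : 4 * (n : ℝ) * (1 / 2) ≤ S * l :=
      mul_le_mul hS4 hl2 (by norm_num) (by positivity)
    have : (0 : ℝ) ≤ n := by positivity
    linarith
  have h8 : M * (S * l + 6 * n * η) ≤ M * (2 * (S * l)) :=
    mul_le_mul_of_nonneg_left (by linarith) (by linarith)
  have h9 : P ≤ 8192 * (M * S * l) := by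
    have : 0 ≤ M * S * l := by positivity
    linarith
  rw [sum_Icc_one_eq_sum_range]
  refine (hvar i).trans ?_
  have h10 : ∑ j ∈ Finset.univ.erase i, L j ≤ P :=
    Finset.sum_le_sum_of_subset_of_nonneg (Finset.erase_subset _ _) fun j _ _ => hL0 j
  have h11 := mul_le_mul_of_nonneg_left (h10.trans h9) (show 0 ≤ (n : ℝ) - 1 by linarith)
  unfold variationConst
  linarith

end Dynamics

theorem mainTheorem3 {n : ℕ} (hn : 2 ≤ n) (A : Fin n → Type*) [∀ i, Fintype (A i)]
    [∀ i, DecidableEq (A i)] (hA : ∀ i, 2 ≤ Fintype.card (A i)) (T : ℕ) (hT : 1 ≤ T) :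
    ∃ D : ∀ i, Learner (A i),
      (∀ i, IsAdaptiveDynamics (oftrlRate A) (variationConst A)
        (√(Fintype.card (A i) * Real.log (Fintype.card (A i)) / T)) (D i)) ∧
      (∀ U : Fin n → (∀ j, A j) → ℝ, (∀ i a, |U i a| ≤ 1) →
        ∀ i, ∀ T' : ℕ, 2 ≤ T' →
          swapRegret (fun t => play U D t i) (fun t => utilityVector U (play U D t) i) T'
            ≤ logRegretBound A i T') ∧
      (∀ i, ∀ u : ℕ → A i → ℝ, (∀ t ≤ T, ‖u t‖ ≤ 1) →
        swapRegret ((D i).run u) u T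
          ≤ logRegretBound A i T
            + 2 * √(Fintype.card (A i) * Real.log (Fintype.card (A i)) * T) + 2) := by
  have hne : ∀ i, Nonempty (A i) := fun i => Fintype.card_pos_iff.1 (by have := hA i; omega)
  have hD := fun i => adaptiveLearner_isAdaptiveDynamics (A := A i) (oftrlRate A)
    (variationConst A) (√(Fintype.card (A i) * Real.log (Fintype.card (A i)) / T))
  refine ⟨fun i => adaptiveLearner (oftrlRate A) (variationConst A)
    (√(Fintype.card (A i) * Real.log (Fintype.card (A i)) / T)), hD, fun U hU i T' hT' => ?_,
    fun i u hu => (hD i).swapRegret_le_adversarial hn hA hT hu⟩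
  have h := (hD i).swapRegret_le_logRegretBound hn hA hT'
    (fun t _ => norm_utilityVector_le_one hU _ i)
    (fun s _ => not_variationExceeds_play hn hA hD hU s i)
  exact (congrArg (fun x => swapRegret x _ T') (funext fun t => play_eq_run U _ t i)).trans_le h
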